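/- Let $T$ be an ergodic automorphism of a standard Borel probability space $(X,\mathcal B,\mu)$. For $g:X\to\mathbb R$ put $g^{(k)}=g+g\circ T+\dots+g\circ T^{k-1}$ for $k>0$, $g^{(0)}=0$ and $g^{(k)}=-(g\circ T^{k}+\dots+g\circ T^{-1})$ for $k<0$. Let $f\in L^2(X,\mu)$ be a (strictly) positive function with $\int_X f\,d\mu=1$, and suppose that there is $c>0$ such that, for all sufficiently large $k\in\mathbb N$, $f^{(k)}\ge ck$ almost everywhere. Put $f_0=f-\int_X f\,d\mu$. Let $X^f=\{(x,s)\in X\times\mathbb R: 0\le s<f(x)\}$, let $\mu^f$ be the restriction of $\mu\otimes\lambda_{\mathbb R}$ to $X^f$ ($\lambda_{\mathbb R}$ is Lebesgue measure), and let $T^f=(T^f_t)_{t\in\mathbb R}$ be the special flow $T^f_t(x,r)=(T^nx,\;r+t-f^{(n)}(x))$, where $n\in\mathbb Z$ is the unique integer with $f^{(n)}(x)\le r+t<f^{(n+1)}(x)$ (defined almost everywhere). For $t_0,\dots,t_{d-1}\in\mathbb R$ let $(\mu^f)_{T^f_{t_0},\dots,T^f_{t_{d-1}}}$ be the off-diagonal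 $(d+1)$-self-joining of $T^f$, that is, the image of $\mu^f$ under $y\mapsto(T^f_{t_0}y,\dots,T^f_{t_{d-1}}y,y)$. For $0\le i\le d-1$ let $(q^i_n)_{n\ge1}$ be a rigidity sequence for $T$, i.e. a sequence of integers with $q^i_n\to\infty$ and $T^{q^i_n}\to \mathrm{Id}$, that is, $\mu(T^{-q_n^i}A\,\triangle\,A)\to0$ for every $A\in\mathcal B$. Suppose that for each $i$ the sequence $(f_0^{(q^i_n)})_{n\ge1}$ is bounded in $L^2(X,\mu)$, and that $$\big(f_0^{(q^0_n)},\dots,f_0^{(q^{d-1}_n)}\big)_*\mu\to P\quad\text{weakly in }\mathcal P(\mathbb R^d).$$ Then $(\mu^f)_{T^f_{t_0},\dots,T^f_{t_{d-1}}}$ (for all $t_0,\dots,t_{d-1}$) and $\int_{\mathbb R^d}(\mu^f)_{T^f_{-t_0},\dots,T^f_{-t_{d-1}}}\,dP(t_0,\dots,t_{d-1})$ are $(d+1)$-self-joinings of $T^f$, and, in the weak topology on $(d+1)$-self-joinings of $T^f$, $$(\mu^f)_{T^f_{q^0_n},\dots,T^f_{q^{d-1}_n}}\;\to\;\int_{\mathbb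 R^d}(\mu^f)_{T^f_{-t_0},\dots,T^f_{-t_{d-1}}}\,dP(t_0,\dots,t_{d-1}),$$ i.e. there is convergence on every box $A_0\times\dots\times A_d$ of measurable subsets of $X^f$; equivalently, there is convergence in the metric $\sum_{n_0,\dots,n_d}2^{-(n_0+\dots+n_d)}|\lambda(B_{n_0}\times\dots\times B_{n_d})-\lambda'(B_{n_0}\times\dots\times B_{n_d})|$ for every countable family $(B_n)$ of measurable sets that is dense for the pseudometric $\mu^f(A\triangle B)$. -/

import Mathlib

open MeasureTheory ProbabilityTheory Filter Topology
open scoped ENNReal NNReal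

noncomputable section

namespace SpecialFlowJoinings

/-- The cocycle generated by `f` over the invertible map `T`: it is `f x + ⋯ + f (T ^ (k - 1) x)` for
`k > 0`, it is `0` for `k = 0`, and it is `-(f (T ^ k x) + ⋯ + f (T⁻¹ x))` for `k < 0`. (At most one
of the two index intervals is nonempty.) -/
def cocycle {X : Type*} (T : Equiv.Perm X) (f : X → ℝ) (k : ℤ) (x : X) : ℝ :=
  (∑ j ∈ Finset.Ico (0 : ℤ) k, f ((T ^ j) x)) - ∑ j ∈ Finset.Ico k (0 : ℤ), f ((T ^ j) x)

theorem cocycle_add_one {X : Type*} (T : Equiv.Perm X) (f : X → ℝ) (k : ℤ) (x : X) :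
    cocycle T f (k + 1) x = cocycle T f k x + f ((T ^ k) x) := by
  unfold cocycle
  rcases le_or_gt 0 k with hk | hk
  · rw [← Finset.insert_Ico_right_eq_Ico_add_one hk, Finset.sum_insert (by simp),
      Finset.Ico_eq_empty (by omega : ¬ k + 1 < 0), Finset.Ico_eq_empty (by omega : ¬ k < 0)]
    ring
  · rw [← Finset.insert_Ico_add_one_left_eq_Ico hk, Finset.sum_insert (by simp),
      Finset.Ico_eq_empty (by omega : ¬ 0 < k + 1), Finset.Ico_eq_empty (by omega : ¬ 0 < k)]
    simp

/-- The phase space of the special flow: the region `0 ≤ s < f x` under the graph of `f`, with the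
measurable structure induced by `X × ℝ`. -/
abbrev Under {X : Type*} (f : X → ℝ) : Type _ :=
  {p : X × ℝ // 0 ≤ p.2 ∧ p.2 < f p.1}

/-- The restriction of `μ ⊗ Lebesgue` to the region under the graph. -/
def underMeasure {X : Type*} [MeasurableSpace X] (μ : Measure X) (f : X → ℝ) :
    Measure (Under f) :=
  (μ.prod (volume : Measure ℝ)).comap Subtype.val

open Classical in
/-- The special flow over `T` under the roof function `f`:
`(x, r)` is sent at time `t` to `(T ^ n x, r + t - f⁽ⁿ⁾ x)`, where `n : ℤ` is the integer with
`f⁽ⁿ⁾ x ≤ r + t < f⁽ⁿ⁺¹⁾ x`. This `n` is unique as `f > 0`; it exists for all `r` and `t` for almost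
every `x`, and points for which there is no such `n` are left fixed. -/
def specialFlow {X : Type*} (T : Equiv.Perm X) (f : X → ℝ) (t : ℝ) (p : Under f) : Under f :=
  if h : ∃ n : ℤ, cocycle T f n p.1.1 ≤ p.1.2 + t ∧ p.1.2 + t < cocycle T f (n + 1) p.1.1 then
    ⟨((T ^ h.choose) p.1.1, p.1.2 + t - cocycle T f h.choose p.1.1), by
      have h1 := h.choose_spec.1
      have h2 := h.choose_spec.2
      rw [cocycle_add_one] at h2
      exact ⟨by dsimp only; linarith, by dsimp only; linarith⟩⟩
  else p

/-- `(q n)` is a rigidity sequence for `T`: `q n → ∞` and `T ^ (q n) → Id`, that is,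
`μ (T ^ (-q n) A ∆ A) → 0` for every measurable set `A`. -/
def IsRigiditySequence {X : Type*} [MeasurableSpace X] (T : Equiv.Perm X) (μ : Measure X)
    (q : ℕ → ℤ) : Prop :=
  Tendsto q atTop atTop ∧
    ∀ A : Set X, MeasurableSet A →
      Tendsto (fun n => μ (symmDiff ((fun x => (T ^ q n) x) ⁻¹' A) A)) atTop (𝓝 0)

/-- `L` is a `k`-self-joining of the flow `φ` on `(Y, ν)`: a probability measure on `Y ^ k`,
invariant under `φ t × ⋯ × φ t` for all `t`, all of whose one-dimensional marginals are `ν`. -/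
structure IsSelfJoining {Y : Type*} [MeasurableSpace Y] (φ : ℝ → Y → Y) (ν : Measure Y) (k : ℕ)
    (L : Measure (Fin k → Y)) : Prop where
  isProbabilityMeasure : IsProbabilityMeasure L
  invariant : ∀ t : ℝ, MeasurePreserving (fun (y : Fin k → Y) i => φ t (y i)) L L
  marginal : ∀ i : Fin k, L.map (fun y => y i) = ν

/-- The joining determined by `S 0, …, S (d - 1)`: the image of `ν` under
`y ↦ (S 0 y, …, S (d - 1) y, y)`, so that the measure of `A 0 × ⋯ × A d` is
`ν ((S 0)⁻¹ (A 0) ∩ ⋯ ∩ (S (d - 1))⁻¹ (A (d - 1)) ∩ A d)`. -/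
def graphJoining {Y : Type*} [MeasurableSpace Y] (ν : Measure Y) {d : ℕ} (S : Fin d → Y → Y) :
    Measure (Fin (d + 1) → Y) :=
  ν.map fun y => (Fin.snoc (fun i => S i y) y : Fin (d + 1) → Y)

/-- The off-diagonal `(d + 1)`-self-joining of the flow `φ` given by the times
`t 0, …, t (d - 1)`. -/
def offDiagonal {Y : Type*} [MeasurableSpace Y] (φ : ℝ → Y → Y) (ν : Measure Y) {d : ℕ}
    (t : Fin d → ℝ) : Measure (Fin (d + 1) → Y) :=
  graphJoining ν fun i => φ (t i)

/-- `B 0, B 1, …` is a countable family of measurable sets that is dense in the σ-algebra for the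
pseudometric `ν (A ∆ B)`. -/
def IsDenseFamily {Y : Type*} [MeasurableSpace Y] (ν : Measure Y) (B : ℕ → Set Y) : Prop :=
  (∀ n, MeasurableSet (B n)) ∧
    ∀ A : Set Y, MeasurableSet A → ∀ ε : ℝ≥0∞, 0 < ε → ∃ n, ν (symmDiff A (B n)) < ε

/-- The metric `∑ 2 ^ (-(n₁ + ⋯ + nₖ)) * |L (B n₁ × ⋯ × B nₖ) - L' (B n₁ × ⋯ × B nₖ)|` on
`k`-self-joinings, attached to a dense family `B`. -/
def joiningDist {Y : Type*} [MeasurableSpace Y] (B : ℕ → Set Y) {k : ℕ}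
    (L L' : Measure (Fin k → Y)) : ℝ :=
  ∑' m : Fin k → ℕ, (1 / 2 : ℝ) ^ (∑ i, m i) *
    |L.real (Set.univ.pi fun i => B (m i)) - L'.real (Set.univ.pi fun i => B (m i))|

/-- Weak convergence of the measures `L n` to `L'` in the space of `k`-self-joinings of a flow on
`(Y, ν)`: convergence on all measurable boxes, and convergence in the metric of every countable
dense family. (For self-joinings these are equivalent.) -/
def JoiningTendsto {Y : Type*} [MeasurableSpace Y] (ν : Measure Y) {k : ℕ}
    (L : ℕ → Measure (Fin k → Y)) (L' : Measure (Fin k → Y)) : Prop :=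
  (∀ A : Fin k → Set Y, (∀ i, MeasurableSet (A i)) →
      Tendsto (fun n => L n (Set.univ.pi A)) atTop (𝓝 (L' (Set.univ.pi A)))) ∧
    ∀ B : ℕ → Set Y, IsDenseFamily ν B →
      Tendsto (fun n => joiningDist B (L n) L') atTop (𝓝 0)

end SpecialFlowJoinings

end

/-!
The special flow is the quotient of the vertical translation flow on `X × ℝ` by the skew product
`(x, r) ↦ (T x, r - f x)`, which preserves `μ ⊗ Lebesgue`. The region under the graph of `f` is a
fundamental domain, and a subset `A` of it corresponds to the invariant set `lift A`, the union of
its preimages under the powers of the skew product. The growth of the cocycle makes almost every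
fibre regular, so that
`T^f_t (x, r) ∈ A` if and only if `(x, r + t) ∈ lift A` (`specialFlow_mem_iff`). Two fundamental
domains give an invariant set the same measure (`measure_inter_eq_of_fundamental`), hence the flow
preserves the measure, and off-diagonal joinings and their averages are joinings.

For an integer time `q` the set `lift A` is invariant under the `q`-th power of the skew product,
so `(x, r + q) ∈ lift A` if and only if `(T ^ q x, r - f₀⁽q⁾ x) ∈ lift A`
(`mem_lift_add_intCast_iff`). Convergence on boxes therefore says that, under the restriction of
`μ ⊗ Lebesgue` to a set `V` of finite measure, the points `(T ^ qᵢ x, r - f₀⁽qᵢ⁾ x)` are jointly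
distributed in the limit like `(x, r - tᵢ)` with `t` of law `P` independent of `(x, r)`. This is
`tendsto_prod_measure_inter_skew`, and it rests on three facts.

* Asymptotic independence. As `f₀⁽q⁾ ∘ T - f₀⁽q⁾ = f ∘ T ^ q - f` tends to `0` in `L²` by rigidity,
  the functions `f₀⁽q⁾` are asymptotically `T`-invariant, and ergodicity forces their limit law to
  be the same on every set of positive measure (`tendsto_measure_inter_preimage_of_ergodic`).
* Rectangles. For rectangles `Uᵢ × Jᵢ` whose second factor has Lebesgue-null frontier, rigidity
  replaces `T ^ qᵢ x ∈ Uᵢ` by `x ∈ Uᵢ`, and on almost every slice `r = const` the set of `t` with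
  `r - tᵢ ∈ Jᵢ` has `P`-null frontier, so the portmanteau theorem applies slice by slice.
* Passage to measurable boxes. A `π`-`λ` argument in each coordinate
  (`tendsto_measure_pi_of_isPiSystem`) needs only that the marginals are countably additive
  uniformly in `n`. They are: the maps `(x, r) ↦ (T ^ q x, r - f₀⁽q⁾ x)` preserve `μ ⊗ Lebesgue`,
  and by Chebyshev's inequality and the `L²` bound they move little mass of `V` far up or down
  (`exists_measure_inter_skew_preimage_le`).
-/

namespace SpecialFlowJoinings

/-! ### Asymptotic independence from ergodicity -/

open scoped InnerProductSpace in
/-- A form of the mean ergodic theorem: a bounded sequence that is asymptotically invariant under an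
isometry `U` tends weakly to `0` as soon as it does so against the fixed vectors of `U`. The vectors
`g` with `⟪v n, g⟫ → 0` form a closed subspace that contains all `U u - u`. A vector `x` orthogonal
to it satisfies `⟪U x, x⟫ = ‖x‖ ^ 2`, hence is fixed by `U`, and so lies in the subspace itself. -/
theorem tendsto_inner_zero_of_asymptotically_invariant {H : Type*} [NormedAddCommGroup H]
    [InnerProductSpace ℝ H] [CompleteSpace H] (U : H →ₗᵢ[ℝ] H) (v : ℕ → H) (C : ℝ)
    (hv : ∀ n, ‖v n‖ ≤ C) (hU : Tendsto (fun n => ‖v n - U (v n)‖) atTop (𝓝 0))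
    (he : ∀ e, U e = e → Tendsto (fun n => ⟪v n, e⟫_ℝ) atTop (𝓝 0)) (g : H) :
    Tendsto (fun n => ⟪v n, g⟫_ℝ) atTop (𝓝 0) := by
  let K : Submodule ℝ H :=
    { carrier := {g | Tendsto (fun n => ⟪v n, g⟫_ℝ) atTop (𝓝 0)}
      add_mem' := fun {a b} ha hb => by
        simpa [inner_add_right] using Tendsto.add (Set.mem_ofPred.1 ha) (Set.mem_ofPred.1 hb)
      zero_mem' := by simp
      smul_mem' := fun c x hx => by
        simpa [inner_smul_right] using Tendsto.const_mul c (Set.mem_ofPred.1 hx) }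
  have hK : ∀ x, x ∈ K ↔ Tendsto (fun n => ⟪v n, x⟫_ℝ) atTop (𝓝 0) := fun x => Iff.rfl
  -- `⟪v n, U u - u⟫ = ⟪v n - U (v n), U u⟫` because `U` preserves inner products.
  have hcob : ∀ u, U u - u ∈ K := fun u => by
    rw [hK]
    have h1 : ∀ n, ⟪v n, U u - u⟫_ℝ = ⟪v n - U (v n), U u⟫_ℝ := fun n => by
      rw [inner_sub_right, inner_sub_left, U.inner_map_map]
    simp_rw [h1]
    have h2 := hU.mul_const ‖U u‖
    rw [zero_mul] at h2
    exact squeeze_zero_norm (fun n => norm_inner_le_norm _ _) h2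
  have hperp : Kᗮ = ⊥ := by
    rw [Submodule.eq_bot_iff]
    intro x hx
    rw [Submodule.mem_orthogonal] at hx
    have h1 : ⟪U x, x⟫_ℝ = ⟪x, x⟫_ℝ := by
      have := hx _ (hcob x)
      rw [inner_sub_left] at this
      linarith
    have h2 : U x = x := by
      have h3 : ‖U x - x‖ ^ 2 = 0 := by
        rw [norm_sub_sq_real, h1, U.norm_map, real_inner_self_eq_norm_sq]
        ring
      simpa [sub_eq_zero] using h3
    simpa using hx x ((hK x).2 (he x h2))
  have hg : g ∈ K.topologicalClosure := by
    rw [Submodule.topologicalClosure_eq_top_iff.2 hperp]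
    trivial
  have hC : 0 ≤ C := (norm_nonneg _).trans (hv 0)
  rw [Metric.tendsto_atTop]
  intro ε hε
  obtain ⟨g', hg'K, hg'⟩ := Metric.mem_closure_iff.1 hg (ε / (2 * (C + 1))) (by positivity)
  obtain ⟨N, hN⟩ := Metric.tendsto_atTop.1 ((hK g').1 hg'K) (ε / 2) (by positivity)
  refine ⟨N, fun n hn => ?_⟩
  have h1 := hN n hn
  rw [Real.dist_eq, sub_zero] at h1 ⊢
  have h2 : |⟪v n, g - g'⟫_ℝ| ≤ C * (ε / (2 * (C + 1))) := by
    refine (abs_real_inner_le_norm _ _).trans ?_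
    rw [dist_eq_norm] at hg'
    exact mul_le_mul (hv n) hg'.le (norm_nonneg _) hC
  have h3 : C * (ε / (2 * (C + 1))) ≤ ε / 2 := by
    rw [mul_div_assoc', div_le_div_iff₀ (by positivity) (by positivity)]
    nlinarith
  have h4 : ⟪v n, g⟫_ℝ = ⟪v n, g - g'⟫_ℝ + ⟪v n, g'⟫_ℝ := by
    rw [← inner_add_right, sub_add_cancel]
  rw [h4]
  linarith [abs_add_le ⟪v n, g - g'⟫_ℝ ⟪v n, g'⟫_ℝ]

/-- Uniformly bounded, asymptotically invariant functions over an ergodic map have asymptotically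
the same mean on every set. -/
theorem tendsto_setIntegral_of_asymptotically_invariant {X : Type*} [MeasurableSpace X]
    {μ : Measure X} [IsProbabilityMeasure μ] {T : X → X} (hT : Ergodic T μ)
    (g : ℕ → X → ℝ) (hg : ∀ n, Measurable (g n)) (C : ℝ) (hC : ∀ n x, |g n x| ≤ C)
    (hinv : Tendsto (fun n => eLpNorm (fun x => g n (T x) - g n x) 2 μ) atTop (𝓝 0))
    (c : ℝ) (hc : Tendsto (fun n => ∫ x, g n x ∂μ) atTop (𝓝 c))
    (W : Set X) (hW : MeasurableSet W) :
    Tendsto (fun n => ∫ x in W, g n x ∂μ) atTop (𝓝 (μ.real W * c)) := by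
  have hTm := hT.toMeasurePreserving
  have hmem : ∀ n, MemLp (fun x => g n x - c) 2 μ := fun n =>
    (MemLp.of_bound (hg n).aestronglyMeasurable C (ae_of_all _ (hC n))).sub (memLp_const c)
  let U := Lp.compMeasurePreservingₗᵢ (E := ℝ) (p := 2) ℝ T hTm
  let v : ℕ → Lp ℝ 2 μ := fun n => (hmem n).toLp
  have hinner : ∀ n (e : Lp ℝ 2 μ), inner ℝ (v n) e = ∫ x, e x * (g n x - c) ∂μ := by
    intro n e
    rw [L2.inner_def]
    refine integral_congr_ae ?_
    filter_upwards [(hmem n).coeFn_toLp] with x hx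
    simp only [v, hx, RCLike.inner_apply, conj_trivial]
  have hgint : ∀ n, Integrable (g n) μ := fun n =>
    Integrable.of_bound (hg n).aestronglyMeasurable C (ae_of_all _ (hC n))
  have key := tendsto_inner_zero_of_asymptotically_invariant U v (C + |c|) ?_ ?_ ?_
    (indicatorConstLp 2 hW (measure_ne_top μ W) (1 : ℝ))
  · have h1 : ∀ n, inner ℝ (v n) (indicatorConstLp 2 hW (measure_ne_top μ W) (1 : ℝ))
        = ∫ x in W, g n x ∂μ - μ.real W * c := by
      intro n
      rw [real_inner_comm, L2.inner_indicatorConstLp_one]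
      rw [setIntegral_congr_ae (g := fun x => g n x - c) hW
        ((hmem n).coeFn_toLp.mono fun x hx _ => hx),
        integral_sub (hgint n).integrableOn (integrable_const c)]
      simp
    simp_rw [h1] at key
    simpa using key.add_const (μ.real W * c)
  · intro n
    have := Lp.norm_le_of_ae_bound (f := v n) (C := C + |c|)
      (add_nonneg ((abs_nonneg _).trans (hC 0 (nonempty_of_isProbabilityMeasure μ).some))
        (abs_nonneg c)) ?_
    · simpa [measureUnivNNReal] using this
    · filter_upwards [(hmem n).coeFn_toLp] with x hx
      rw [hx]
      exact (norm_sub_le _ _).trans (by gcongr; exacts [hC n x, le_rfl])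
  · have h1 : ∀ n, ‖v n - U (v n)‖ = (eLpNorm (fun x => g n (T x) - g n x) 2 μ).toReal := by
      intro n
      rw [norm_sub_rev, Lp.norm_def]
      congr 1
      refine eLpNorm_congr_ae ?_
      have h2 := hTm.quasiMeasurePreserving.ae (hmem n).coeFn_toLp
      filter_upwards [Lp.coeFn_sub (U (v n)) (v n), Lp.coeFn_compMeasurePreserving (v n) hTm, h2,
        (hmem n).coeFn_toLp] with x hx h3 h4 h5
      rw [hx, Pi.sub_apply]
      have h6 : (U (v n)) x = g n (T x) - c := h3.trans h4
      rw [h6]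
      simp only [v, h5]
      ring
    simp_rw [h1]
    exact (ENNReal.tendsto_toReal ENNReal.zero_ne_top).comp hinv
  · intro e he
    have h1 : (e : X → ℝ) ∘ T =ᵐ[μ] e := by
      have h2 := Lp.coeFn_compMeasurePreserving e hTm
      have h3 : Lp.compMeasurePreserving T hTm e = e := he
      rw [h3] at h2
      exact h2.symm
    obtain ⟨a, ha⟩ := hT.ae_eq_const_of_ae_eq_comp_ae (Lp.aestronglyMeasurable e) h1
    have h2 : ∀ n, inner ℝ (v n) e = a * (∫ x, g n x ∂μ - c) := by
      intro n
      rw [hinner, integral_congr_ae (g := fun x => a * (g n x - c))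
        (ha.mono fun x hx => by simp [hx]), integral_const_mul,
        integral_sub (hgint n) (integrable_const c)]
      simp
    simp_rw [h2]
    simpa using (hc.sub_const c).const_mul a

/-- If `F n` converges in distribution and `F n ∘ T - F n → 0` in `L²` for an ergodic `T`, then
`F n` is asymptotically independent of every event `W` (mixing convergence in Rényi's sense). -/
theorem tendsto_measure_inter_preimage_of_ergodic {X E : Type*} [MeasurableSpace X]
    {μ : Measure X} [IsProbabilityMeasure μ] {T : X → X} (hT : Ergodic T μ)
    [NormedAddCommGroup E] [MeasurableSpace E] [BorelSpace E]
    (F : ℕ → X → E) (hF : ∀ n, Measurable (F n))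
    (hinv : Tendsto (fun n => eLpNorm (fun x => F n (T x) - F n x) 2 μ) atTop (𝓝 0))
    (P : Measure E) [IsProbabilityMeasure P]
    (hP : TendstoInDistribution F atTop id (fun _ => μ) P)
    (W : Set X) (hW : MeasurableSet W) (S : Set E) (hS : MeasurableSet S)
    (hPS : P (frontier S) = 0) :
    Tendsto (fun n => μ (W ∩ F n ⁻¹' S)) atTop (𝓝 (μ W * P S)) := by
  by_cases hW0 : μ W = 0
  · simp [hW0, measure_inter_null_of_null_left]
  have hcond : IsProbabilityMeasure μ[|W] := cond_isProbabilityMeasure hW0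
  let ν : ℕ → ProbabilityMeasure E := fun n =>
    ⟨(μ[|W]).map (F n), Measure.isProbabilityMeasure_map (hF n).aemeasurable⟩
  have hν : Tendsto ν atTop (𝓝 (⟨P, inferInstance⟩ : ProbabilityMeasure E)) := by
    refine tendsto_iff_forall_lipschitz_integral_tendsto.2 ?_
    rintro h ⟨B, hB⟩ ⟨L, hL⟩
    have hhm : Measurable h := hL.continuous.measurable
    have hP' := tendsto_iff_forall_lipschitz_integral_tendsto.1 hP.tendsto h ⟨B, hB⟩ ⟨L, hL⟩
    simp only [ProbabilityMeasure.coe_mk, Measure.map_id] at hP'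
    have e1 : ∀ n, ∫ y, h y ∂(μ.map (F n)) = ∫ x, h (F n x) ∂μ := fun n =>
      integral_map (hF n).aemeasurable hhm.aestronglyMeasurable
    simp_rw [e1] at hP'
    have key := tendsto_setIntegral_of_asymptotically_invariant hT (fun n x => h (F n x))
      (fun n => hhm.comp (hF n)) (|h 0| + B) ?_ ?_ _ hP' W hW
    · have e2 : ∀ n, ∫ y, h y ∂(ν n : Measure E) = (μ W).toReal⁻¹ * ∫ x in W, h (F n x) ∂μ := by
        intro n
        simp only [ν, ProbabilityMeasure.coe_mk]
        rw [integral_map (hF n).aemeasurable hhm.aestronglyMeasurable, ProbabilityTheory.cond,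
          integral_smul_measure]
        simp
      simp_rw [e2]
      have h3 := key.const_mul ((μ W).toReal⁻¹)
      rw [← mul_assoc, measureReal_def, inv_mul_cancel₀
        (ENNReal.toReal_ne_zero.2 ⟨hW0, measure_ne_top μ W⟩), one_mul] at h3
      exact h3
    · intro n x
      have h1 := hB (F n x) 0
      rw [Real.dist_eq] at h1
      have h2 := abs_add_le (h (F n x) - h 0) (h 0)
      rw [sub_add_cancel] at h2
      linarith
    · have h1 := ENNReal.Tendsto.const_mul (a := (L : ℝ≥0∞)) hinv (Or.inr ENNReal.coe_ne_top)
      rw [mul_zero] at h1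
      refine tendsto_of_tendsto_of_tendsto_of_le_of_le tendsto_const_nhds h1
        (fun _ => zero_le) fun n => ?_
      refine eLpNorm_le_nnreal_smul_eLpNorm_of_ae_le_mul (ae_of_all _ fun x => ?_) 2
      have := hL.dist_le_mul (F n (T x)) (F n x)
      rw [dist_eq_norm, dist_eq_norm] at this
      exact_mod_cast this
  have h1 := ProbabilityMeasure.tendsto_measure_of_null_frontier_of_tendsto' hν (E := S) hPS
  have h2 := ENNReal.Tendsto.const_mul (a := μ W) h1 (Or.inr (measure_ne_top μ W))
  refine h2.congr fun n => ?_
  simp only [ν, ProbabilityMeasure.coe_mk]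
  rw [Measure.map_apply (hF n) hS, mul_comm, cond_mul_eq_inter hW]

theorem tendsto_eLpNorm_comp_sub_of_rigid {X : Type*} [MeasurableSpace X]
    {μ : Measure X} (R : ℕ → X → X) (hR : ∀ n, MeasurePreserving (R n) μ μ)
    (hrig : ∀ A, MeasurableSet A → Tendsto (fun n => μ (symmDiff (R n ⁻¹' A) A)) atTop (𝓝 0))
    (f : X → ℝ) (hf : MemLp f 2 μ) :
    Tendsto (fun n => eLpNorm (fun x => f (R n x) - f x) 2 μ) atTop (𝓝 0) := by
  have hcomp : ∀ (a : X → ℝ), MemLp a 2 μ → ∀ n, MemLp (fun x => a (R n x)) 2 μ := fun a ha n =>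
    ha.comp_measurePreserving (hR n)
  have hnorm : ∀ (a : X → ℝ), MemLp a 2 μ → ∀ n, eLpNorm (fun x => a (R n x)) 2 μ = eLpNorm a 2 μ :=
    fun a ha n => eLpNorm_comp_measurePreserving ha.1 (hR n)
  refine MemLp.induction (by simp) (motive := fun f : X → ℝ =>
    Tendsto (fun n => eLpNorm (fun x => f (R n x) - f x) 2 μ) atTop (𝓝 0)) ?_ ?_ ?_ ?_ hf
  · intro c s hs _
    have h1 : ∀ n, eLpNorm (fun x => s.indicator (fun _ => c) (R n x) - s.indicator (fun _ => c) x)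
        2 μ = ‖c‖ₑ * μ (symmDiff (R n ⁻¹' s) s) ^ (1 / (2 : ℝ)) := by
      intro n
      have hms : MeasurableSet (symmDiff (R n ⁻¹' s) s) := ((hR n).measurable hs).symmDiff hs
      have := eLpNorm_indicator_const (p := 2) (μ := μ) (c := c) hms (by simp) (by simp)
      rw [ENNReal.toReal_ofNat] at this
      rw [← this]
      refine eLpNorm_congr_norm_ae (ae_of_all _ fun x => ?_)
      by_cases h1 : R n x ∈ s <;> by_cases h2 : x ∈ s <;>
        simp [Set.indicator, Set.mem_symmDiff, h1, h2]
    simp_rw [h1]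
    have h2 := ((hrig s hs).ennrpow_const (1 / (2 : ℝ)))
    rw [ENNReal.zero_rpow_of_pos (by norm_num)] at h2
    have h3 := ENNReal.Tendsto.const_mul (a := ‖c‖ₑ) h2 (Or.inr enorm_ne_top)
    rwa [mul_zero] at h3
  · intro a b _ ha hb h1 h2
    have h3 := h1.add h2
    rw [add_zero] at h3
    refine tendsto_of_tendsto_of_tendsto_of_le_of_le tendsto_const_nhds h3
        (fun _ => zero_le) fun n => ?_
    refine le_trans (le_of_eq ?_) (eLpNorm_add_le ((hcomp a ha n).sub ha).1
      ((hcomp b hb n).sub hb).1 (by norm_num))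
    congr 1
    ext x
    simp only [Pi.add_apply]
    ring
  · rw [← isSeqClosed_iff_isClosed]
    intro u a hu hua
    rw [Set.mem_ofPred, ENNReal.tendsto_nhds_zero]
    intro ε hε
    obtain ⟨k, hk⟩ : ∃ k, eLpNorm (fun x => u k x - a x) 2 μ ≤ ε / 3 := by
      have h1 := (Lp.tendsto_Lp_iff_tendsto_eLpNorm' u a).1 hua
      obtain ⟨k, hk⟩ := (ENNReal.tendsto_nhds_zero.1 h1 (ε / 3)
        (ENNReal.div_pos hε.ne' (by simp))).exists
      exact ⟨k, hk⟩
    filter_upwards [ENNReal.tendsto_nhds_zero.1 (hu k) (ε / 3)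
      (ENNReal.div_pos hε.ne' (by simp))] with n hn
    have hd := (Lp.memLp (u k)).sub (Lp.memLp a)
    have e1 : (fun x => a (R n x) - a x) = fun x =>
        ((u k (R n x) - u k x) - (u k (R n x) - a (R n x))) + (u k x - a x) := by
      ext x; ring
    have m1 := (hcomp _ (Lp.memLp (u k)) n).sub (Lp.memLp (u k))
    have m2 := (hcomp _ (Lp.memLp (u k)) n).sub (hcomp _ (Lp.memLp a) n)
    have m3 := hnorm _ hd n
    rw [e1]
    calc _ ≤ eLpNorm (fun x => (u k (R n x) - u k x) - (u k (R n x) - a (R n x))) 2 μ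
            + eLpNorm (fun x => u k x - a x) 2 μ := eLpNorm_add_le (m1.sub m2).1 hd.1 (by norm_num)
      _ ≤ (eLpNorm (fun x => u k (R n x) - u k x) 2 μ
            + eLpNorm (fun x => u k (R n x) - a (R n x)) 2 μ)
            + eLpNorm (fun x => u k x - a x) 2 μ := by
          gcongr
          exact eLpNorm_sub_le m1.1 m2.1 (by norm_num)
      _ ≤ (ε / 3 + ε / 3) + ε / 3 := by
          gcongr
          exact m3.le.trans hk
      _ = ε := ENNReal.add_thirds ε
  · intro a b hab ha h1
    refine h1.congr fun n => eLpNorm_congr_ae ?_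
    filter_upwards [hab, (hR n).quasiMeasurePreserving.ae hab] with x h2 h3
    rw [h2, h3]

/-! ### Convergence of measures on boxes -/

theorem exists_measure_le_of_antitone {Y : Type*} [MeasurableSpace Y] (ρ : Measure Y)
    {D : ℕ → Set Y} (hD : Antitone D) (hDm : ∀ k, MeasurableSet (D k)) (hDe : ⋂ k, D k = ∅)
    (hfin : ρ (D 0) ≠ ∞) {ε : ℝ≥0∞} (hε : 0 < ε) : ∃ K, ∀ k, K ≤ k → ρ (D k) ≤ ε := by
  have h := tendsto_measure_iInter_atTop (fun k => (hDm k).nullMeasurableSet) hD ⟨0, hfin⟩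
  rw [hDe, measure_empty] at h
  exact eventually_atTop.1 (ENNReal.tendsto_nhds_zero.1 h ε hε)

/-- Convergence of finite measures extends from a generating `π`-system to all measurable sets when
the measures are countably additive uniformly in `n` (the hypothesis `huc`); this is what makes the
class of good sets closed under countable disjoint unions. -/
theorem tendsto_measure_of_isPiSystem {Y : Type*} [mY : MeasurableSpace Y] (ρ : ℕ → Measure Y)
    (ρ' : Measure Y) [∀ n, IsFiniteMeasure (ρ n)] [IsFiniteMeasure ρ'] (C : Set (Set Y))
    (hgen : mY = MeasurableSpace.generateFrom C) (hpi : IsPiSystem C) (huniv : Set.univ ∈ C)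
    (hC : ∀ B ∈ C, Tendsto (fun n => ρ n B) atTop (𝓝 (ρ' B)))
    (huc : ∀ D : ℕ → Set Y, Antitone D → (∀ k, MeasurableSet (D k)) → ⋂ k, D k = ∅ →
      ∀ ε : ℝ≥0∞, 0 < ε → ∃ K, ∀ n, ρ n (D K) ≤ ε) (B : Set Y) (hB : MeasurableSet B) :
    Tendsto (fun n => ρ n B) atTop (𝓝 (ρ' B)) := by
  induction B, hB using MeasurableSpace.induction_on_inter hgen hpi with
  | empty => simp
  | basic t ht => exact hC t ht
  | compl t htm h =>
    simp_rw [measure_compl htm (measure_ne_top _ t)]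
    exact ENNReal.Tendsto.sub (hC _ huniv) h (Or.inl (measure_ne_top _ _))
  | iUnion g hd hm h =>
    let s : ℕ → Set Y := fun K => ⋃ k ∈ Finset.range K, g k
    -- The tails `D K` decrease to `∅`, so `ρ n (D K)` is small uniformly in `n`.
    let D : ℕ → Set Y := fun K => ⋃ k ∈ Set.Ici K, g k
    have hs : ∀ K, Tendsto (fun n => ρ n (s K)) atTop (𝓝 (ρ' (s K))) := fun K => by
      have e : ∀ κ : Measure Y, κ (s K) = ∑ k ∈ Finset.range K, κ (g k) := fun κ =>
        measure_biUnion_finset (fun a _ b _ hab => hd hab) fun k _ => hm k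
      simp_rw [e]
      exact tendsto_finsetSum _ fun k _ => h k
    have hDm : ∀ K, MeasurableSet (D K) := fun K =>
      MeasurableSet.biUnion (Set.to_countable _) fun k _ => hm k
    have hDa : Antitone D := fun a b hab =>
      Set.biUnion_subset_biUnion_left (Set.Ici_subset_Ici.2 hab)
    have hDe : ⋂ K, D K = ∅ := by
      refine Set.eq_empty_iff_forall_notMem.2 fun y hy => ?_
      rw [Set.mem_iInter] at hy
      obtain ⟨i, -, hi⟩ := Set.mem_iUnion₂.1 (hy 0)
      obtain ⟨j, hj, hj'⟩ := Set.mem_iUnion₂.1 (hy (i + 1))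
      rw [Set.mem_Ici] at hj
      exact Set.disjoint_left.1 (hd (by omega : i ≠ j)) hi hj'
    have hsub : ∀ K, ⋃ k, g k ⊆ s K ∪ D K := fun K => by
      refine Set.iUnion_subset fun k y hy => ?_
      rcases lt_or_ge k K with hk | hk
      · exact Or.inl (Set.mem_iUnion₂.2 ⟨k, Finset.mem_range.2 hk, hy⟩)
      · exact Or.inr (Set.mem_iUnion₂.2 ⟨k, hk, hy⟩)
    have hsup : ∀ K, s K ⊆ ⋃ k, g k := fun K =>
      Set.iUnion₂_subset fun k _ => Set.subset_iUnion g k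
    rw [ENNReal.tendsto_nhds (measure_ne_top _ _)]
    intro ε hε
    have hε2 : 0 < ε / 2 := ENNReal.half_pos hε.ne'
    obtain ⟨K₁, hK₁⟩ := huc D hDa hDm hDe (ε / 2) hε2
    obtain ⟨K₂, hK₂⟩ := exists_measure_le_of_antitone ρ' hDa hDm hDe (measure_ne_top _ _) hε2
    let K := max K₁ K₂
    have a1 : ∀ n, ρ n (⋃ k, g k) ≤ ρ n (s K) + ε / 2 := fun n =>
      (measure_mono (hsub K)).trans <| (measure_union_le _ _).trans <| by
        gcongr
        exact (measure_mono (hDa (le_max_left _ _))).trans (hK₁ n)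
    have a2 : ρ' (⋃ k, g k) ≤ ρ' (s K) + ε / 2 :=
      (measure_mono (hsub K)).trans <| (measure_union_le _ _).trans <| by
        gcongr
        exact hK₂ _ (le_max_right _ _)
    filter_upwards [(ENNReal.tendsto_nhds (measure_ne_top _ _)).1 (hs K) (ε / 2) hε2] with n hn
    have b1 : ρ' (s K) ≤ ρ n (s K) + ε / 2 := tsub_le_iff_right.1 hn.1
    refine ⟨tsub_le_iff_right.2 ?_, ?_⟩
    · calc _ ≤ ρ' (s K) + ε / 2 := a2
        _ ≤ ρ n (s K) + ε / 2 + ε / 2 := by gcongr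
        _ = ρ n (s K) + ε := by rw [add_assoc, ENNReal.add_halves]
        _ ≤ _ := by gcongr; exact hsup K
    · calc _ ≤ ρ n (s K) + ε / 2 := a1 n
        _ ≤ ρ' (s K) + ε / 2 + ε / 2 := by gcongr; exact hn.2
        _ = ρ' (s K) + ε := by rw [add_assoc, ENNReal.add_halves]
        _ ≤ _ := by gcongr; exact hsup K

/-- Convergence of finite measures on boxes extends from boxes with sides in a generating `π`-system
to all measurable boxes, one coordinate at a time, when each family of marginals is countably
additive uniformly in `n`. -/
theorem tendsto_measure_pi_of_isPiSystem {ι Y : Type*} [Fintype ι] [mY : MeasurableSpace Y]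
    (ν : ℕ → Measure (ι → Y)) (ν' : Measure (ι → Y)) [∀ n, IsFiniteMeasure (ν n)]
    [IsFiniteMeasure ν'] (C : Set (Set Y)) (hgen : mY = MeasurableSpace.generateFrom C)
    (hpi : IsPiSystem C) (huniv : Set.univ ∈ C)
    (hC : ∀ B : ι → Set Y, (∀ i, B i ∈ C) →
      Tendsto (fun n => ν n (Set.univ.pi B)) atTop (𝓝 (ν' (Set.univ.pi B))))
    (huc : ∀ i, ∀ D : ℕ → Set Y, Antitone D → (∀ k, MeasurableSet (D k)) → ⋂ k, D k = ∅ →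
      ∀ ε : ℝ≥0∞, 0 < ε → ∃ K, ∀ n, ν n ((fun y => y i) ⁻¹' D K) ≤ ε)
    (A : ι → Set Y) (hA : ∀ i, MeasurableSet (A i)) :
    Tendsto (fun n => ν n (Set.univ.pi A)) atTop (𝓝 (ν' (Set.univ.pi A))) := by
  classical
  have hCm : ∀ B ∈ C, MeasurableSet B := fun B hB => hgen ▸ .basic B hB
  suffices H : ∀ s : Finset ι, ∀ A : ι → Set Y, (∀ i ∈ s, MeasurableSet (A i)) →
      (∀ i ∉ s, A i ∈ C) → Tendsto (fun n => ν n (Set.univ.pi A)) atTop (𝓝 (ν' (Set.univ.pi A))) from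
    H Finset.univ A (fun i _ => hA i) fun i hi => absurd (Finset.mem_univ i) hi
  intro s
  induction s using Finset.induction_on with
  | empty => exact fun A _ h => hC A fun i => h i (by simp)
  | insert j s hj ih =>
    intro A h1 h2
    let G : Set (ι → Y) := Set.pi {j}ᶜ A
    have hAm : ∀ i, MeasurableSet (A i) := fun i => by
      by_cases hi : i ∈ insert j s
      · exact h1 i hi
      · exact hCm _ (h2 i hi)
    have hG : MeasurableSet G := MeasurableSet.pi (Set.to_countable _) fun i _ => hAm i
    have hev : Measurable fun y : ι → Y => y j := measurable_pi_apply j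
    have hbox : ∀ (κ : Measure (ι → Y)) (B : Set Y), MeasurableSet B →
        ((κ.restrict G).map fun y => y j) B = κ (Set.univ.pi (Function.update A j B)) := by
      intro κ B hB
      rw [Measure.map_apply hev hB, Measure.restrict_apply (hev hB)]
      congr 1
      ext y
      simp only [G, Set.mem_inter_iff, Set.mem_preimage, Set.mem_pi, Set.mem_univ, forall_const]
      constructor
      · rintro ⟨h, h'⟩ i
        by_cases hi : i = j
        · subst hi; simpa using h
        · simpa [hi] using h' i hi
      · intro h
        refine ⟨by simpa using h j, fun i hi => ?_⟩
        have hij : i ≠ j := hi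
        simpa [hij] using h i
    have key := tendsto_measure_of_isPiSystem (fun n => ((ν n).restrict G).map fun y => y j)
      ((ν'.restrict G).map fun y => y j) C hgen hpi huniv ?_ ?_ (A j) (hAm j)
    · simp_rw [hbox _ _ (hAm j), Function.update_eq_self] at key
      exact key
    · intro B hB
      simp_rw [hbox _ _ (hCm B hB)]
      refine ih _ (fun i hi => ?_) fun i hi => ?_
      · have hij : i ≠ j := fun h => hj (h ▸ hi)
        simpa [hij] using hAm i
      · by_cases hij : i = j
        · subst hij; simpa using hB
        · simpa [hij] using h2 i (by simp [hij, hi])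
    · intro D hDa hDm hDe ε hε
      obtain ⟨K, hK⟩ := huc j D hDa hDm hDe ε hε
      refine ⟨K, fun n => ?_⟩
      rw [Measure.map_apply hev (hDm K)]
      exact (Measure.restrict_apply_le _ _).trans (hK n)

/-! ### Skew products over a rigid sequence -/

/-- The images of the restriction of `μ ⊗ Lebesgue` to `V` under the skew maps
`(x, r) ↦ (R n x, r - F n x)` are countably additive uniformly in `n`. On bounded heights they are
dominated by `μ ⊗ Lebesgue`, and the `L²` bound on `F n` controls the mass at large heights. -/
theorem exists_measure_inter_skew_preimage_le {X : Type*} [MeasurableSpace X] {μ : Measure X}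
    [IsProbabilityMeasure μ] (R : ℕ → X → X) (hR : ∀ n, MeasurePreserving (R n) μ μ)
    (F : ℕ → X → ℝ) (hF : ∀ n, Measurable (F n)) (C : ℝ≥0) (hC : ∀ n, eLpNorm (F n) 2 μ ≤ C)
    (V : Set (X × ℝ)) (hV : MeasurableSet V) (hVfin : (μ.prod volume) V ≠ ∞)
    (D : ℕ → Set (X × ℝ)) (hDa : Antitone D) (hDm : ∀ k, MeasurableSet (D k))
    (hDe : ⋂ k, D k = ∅) (ε : ℝ≥0∞) (hε : 0 < ε) :
    ∃ K, ∀ n, (μ.prod volume) (V ∩ (fun p : X × ℝ => (R n p.1, p.2 - F n p.1)) ⁻¹' D K) ≤ ε := by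
  have hε3 : 0 < ε / 3 := ENNReal.div_pos hε.ne' (by simp)
  have hMP : ∀ n, MeasurePreserving (fun p : X × ℝ => (R n p.1, p.2 - F n p.1))
      (μ.prod volume) (μ.prod volume) := fun n =>
    (hR n).skew_product (g := fun x r => r - F n x) (by have := hF n; fun_prop)
      (ae_of_all _ fun x => map_sub_right_eq_self volume (F n x))
  -- Little of `V` lies at heights above `L`; on the part below `L`, Chebyshev's inequality bounds
  -- the mass displaced by `M` or more; the rest stays at heights at most `L + M`.
  obtain ⟨L, hL⟩ := exists_measure_le_of_antitone (μ.prod volume)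
    (D := fun k : ℕ => V ∩ {p : X × ℝ | (k : ℝ) < |p.2|})
    (fun a b hab => Set.inter_subset_inter_right _ fun (p : X × ℝ) (hp : (b : ℝ) < |p.2|) =>
      show (a : ℝ) < |p.2| from lt_of_le_of_lt (by exact_mod_cast hab) hp)
    (fun k => hV.inter (measurableSet_lt measurable_const (by fun_prop)))
    (by
      refine Set.eq_empty_iff_forall_notMem.2 fun p hp => ?_
      rw [Set.mem_iInter] at hp
      obtain ⟨k, hk⟩ := exists_nat_gt |p.2|
      exact absurd (hp k).2 (not_lt.2 hk.le))
    (measure_ne_top_of_subset Set.inter_subset_left hVfin) hε3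
  obtain ⟨M, hM⟩ : ∃ M : ℕ, ((M : ℝ≥0∞)⁻¹ ^ (2 : ℝ) * (C : ℝ≥0∞) ^ (2 : ℝ)) *
      volume (Set.Icc (-(L : ℝ)) L) ≤ ε / 3 ∧ 0 < M := by
    have h1 := ENNReal.tendsto_inv_nat_nhds_zero.ennrpow_const (2 : ℝ)
    rw [ENNReal.zero_rpow_of_pos (by norm_num)] at h1
    have h2 := ENNReal.Tendsto.mul_const (ENNReal.Tendsto.mul_const h1
      (Or.inr (ENNReal.rpow_ne_top_of_nonneg (y := 2) (by norm_num) (ENNReal.coe_ne_top (r := C)))))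
      (Or.inr (measure_Icc_lt_top (μ := volume) (a := -(L : ℝ)) (b := L)).ne)
    rw [zero_mul, zero_mul] at h2
    obtain ⟨M, h3, h4⟩ := ((ENNReal.tendsto_nhds_zero.1 h2 _ hε3).and (eventually_gt_atTop 0)).exists
    exact ⟨M, h3, h4⟩
  have hfin : (μ.prod volume) (D 0 ∩ {p : X × ℝ | |p.2| ≤ L + M}) ≠ ∞ := by
    refine measure_ne_top_of_subset (s := (Set.univ : Set X) ×ˢ Set.Icc (-(L + M : ℝ)) (L + M)) ?_ ?_
    · exact fun p hp => ⟨trivial, abs_le.1 hp.2⟩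
    · rw [Measure.prod_prod]
      exact ENNReal.mul_ne_top (measure_ne_top _ _) measure_Icc_lt_top.ne
  obtain ⟨K, hK⟩ := exists_measure_le_of_antitone (μ.prod volume)
    (D := fun k : ℕ => D k ∩ {p : X × ℝ | |p.2| ≤ L + M})
    (fun a b hab => Set.inter_subset_inter_left _ (hDa hab))
    (fun k => (hDm k).inter (measurableSet_le (by fun_prop) measurable_const))
    (by rw [← Set.iInter_inter, hDe, Set.empty_inter]) hfin hε3
  refine ⟨K, fun n => ?_⟩
  have hsub : V ∩ (fun p : X × ℝ => (R n p.1, p.2 - F n p.1)) ⁻¹' D K ⊆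
      ((V ∩ {p : X × ℝ | (L : ℝ) < |p.2|}) ∪ ({x | (M : ℝ≥0∞) ≤ ‖F n x‖ₑ} ×ˢ Set.Icc (-(L : ℝ)) L)) ∪
        (fun p : X × ℝ => (R n p.1, p.2 - F n p.1)) ⁻¹' (D K ∩ {p : X × ℝ | |p.2| ≤ L + M}) := by
    rintro ⟨x, r⟩ ⟨h1, h2⟩
    by_cases h3 : (L : ℝ) < |r|
    · exact Or.inl (Or.inl ⟨h1, h3⟩)
    rw [not_lt] at h3
    by_cases h4 : (M : ℝ≥0∞) ≤ ‖F n x‖ₑ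
    · exact Or.inl (Or.inr ⟨h4, abs_le.1 h3⟩)
    refine Or.inr ⟨h2, ?_⟩
    have h5 : |F n x| ≤ M := by
      rw [not_le, Real.enorm_eq_ofReal_abs, ENNReal.ofReal_lt_natCast hM.2.ne'] at h4
      exact h4.le
    exact (abs_sub _ _).trans (add_le_add h3 h5)
  refine (measure_mono hsub).trans <| (measure_union_le _ _).trans ?_
  rw [← ENNReal.add_thirds ε]
  refine add_le_add ((measure_union_le _ _).trans (add_le_add (hL L le_rfl) ?_)) ?_
  · rw [Measure.prod_prod]
    refine le_trans ?_ hM.1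
    gcongr
    have h6 := meas_ge_le_mul_pow_eLpNorm_enorm (p := 2) (by simp) (by simp)
      (hF n).aestronglyMeasurable (μ := μ) (ε := M) (by simpa using hM.2.ne') (by simp)
    rw [ENNReal.toReal_ofNat] at h6
    refine h6.trans ?_
    gcongr
    exact hC n
  · rw [(hMP n).measure_preimage ((hDm K).inter
      (measurableSet_le (by fun_prop) measurable_const)).nullMeasurableSet]
    exact hK K le_rfl

theorem frontier_pi_subset {ι : Type*} [Finite ι] {Y : Type*} [TopologicalSpace Y]
    (J : ι → Set Y) :
    frontier (Set.univ.pi J) ⊆ ⋃ i, (fun y : ι → Y => y i) ⁻¹' frontier (J i) := by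
  rw [frontier, closure_pi_set, interior_pi_set Set.finite_univ]
  rintro y ⟨h1, h2⟩
  simp only [Set.mem_pi, Set.mem_univ, forall_const, not_forall] at h1 h2
  obtain ⟨i, hi⟩ := h2
  exact Set.mem_iUnion.2 ⟨i, h1 i, hi⟩

/-- For almost every `r` the frontier of `{t | ∀ i, r - t i ∈ J i}` is `P`-null, even if `P` has
atoms, since averaging over `r` turns `P` into Lebesgue measure in each coordinate. -/
theorem ae_measure_frontier_eq_zero {ι : Type*} [Fintype ι] (P : Measure (ι → ℝ))
    [IsProbabilityMeasure P] (J : ι → Set ℝ) (hJ : ∀ i, volume (frontier (J i)) = 0) :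
    ∀ᵐ r : ℝ, P (frontier {t : ι → ℝ | ∀ i, r - t i ∈ J i}) = 0 := by
  have h1 : ∀ i, ∀ᵐ r : ℝ, ∀ᵐ t ∂P, r - t i ∉ frontier (J i) := by
    intro i
    refine (Measure.ae_ae_comm ?_).1 (ae_of_all _ fun t => ?_)
    · exact (isClosed_frontier.measurableSet.preimage (by fun_prop :
        Measurable fun x : (ι → ℝ) × ℝ => x.2 - x.1 i)).compl
    · have : volume ((fun r => r - t i) ⁻¹' frontier (J i)) = 0 := by
        rw [(measurePreserving_sub_right volume (t i)).measure_preimage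
          isClosed_frontier.measurableSet.nullMeasurableSet, hJ i]
      exact measure_eq_zero_iff_ae_notMem.1 this
  filter_upwards [ae_all_iff.2 h1] with r hr
  have hc : Continuous fun (t : ι → ℝ) (i : ι) => r - t i := by fun_prop
  have e : {t : ι → ℝ | ∀ i, r - t i ∈ J i} = (fun (t : ι → ℝ) (i : ι) => r - t i) ⁻¹'
      Set.univ.pi J := by
    ext t; simp
  rw [e, measure_eq_zero_iff_ae_notMem]
  filter_upwards [ae_all_iff.2 hr] with t ht h
  obtain ⟨i, hi⟩ := Set.mem_iUnion.1 (frontier_pi_subset J (hc.frontier_preimage_subset _ h))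
  exact ht i hi

theorem tendsto_of_le_add {a b e : ℕ → ℝ≥0∞} {l : ℝ≥0∞} (hb : Tendsto b atTop (𝓝 l))
    (hl : l ≠ ∞) (he : Tendsto e atTop (𝓝 0)) (h1 : ∀ n, a n ≤ b n + e n)
    (h2 : ∀ n, b n ≤ a n + e n) : Tendsto a atTop (𝓝 l) := by
  have h3 := hb.add he
  have h4 := ENNReal.Tendsto.sub hb he (Or.inl hl)
  rw [add_zero] at h3
  rw [tsub_zero] at h4
  exact tendsto_of_tendsto_of_tendsto_of_le_of_le h4 h3
    (fun n => tsub_le_iff_right.2 (h2 n)) h1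

/-- Along rigid sequences, `R i n x ∈ U i` may be replaced by `x ∈ U i` in the limit, uniformly over
the events `G n`. -/
theorem tendsto_measure_inter_rigid {X ι : Type*} [Fintype ι] [MeasurableSpace X]
    {μ : Measure X} [IsProbabilityMeasure μ] (R : ι → ℕ → X → X)
    (hrig : ∀ i, ∀ A, MeasurableSet A →
      Tendsto (fun n => μ (symmDiff (R i n ⁻¹' A) A)) atTop (𝓝 0))
    (U : ι → Set X) (hU : ∀ i, MeasurableSet (U i)) (G : ℕ → Set X) (l : ℝ≥0∞) (hl : l ≠ ∞)
    (hG : Tendsto (fun n => μ ({x | ∀ i, x ∈ U i} ∩ G n)) atTop (𝓝 l)) :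
    Tendsto (fun n => μ ({x | ∀ i, R i n x ∈ U i} ∩ G n)) atTop (𝓝 l) := by
  have he : Tendsto (fun n => ∑ i, μ (symmDiff (R i n ⁻¹' U i) (U i))) atTop (𝓝 0) := by
    simpa using tendsto_finsetSum Finset.univ fun i _ => hrig i (U i) (hU i)
  have hle : ∀ n, μ (⋃ i, symmDiff (R i n ⁻¹' U i) (U i)) ≤
      ∑ i, μ (symmDiff (R i n ⁻¹' U i) (U i)) := fun n => by
    simpa using measure_iUnion_le (μ := μ) fun i => symmDiff (R i n ⁻¹' U i) (U i)
  refine tendsto_of_le_add hG hl he (fun n => ?_) fun n => ?_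
  · refine le_trans (measure_mono ?_) ((measure_union_le _ _).trans (add_le_add le_rfl (hle n)))
    rintro x ⟨h1, h2⟩
    by_cases h3 : ∀ i, x ∈ U i
    · exact Or.inl ⟨h3, h2⟩
    · obtain ⟨i, hi⟩ := not_forall.1 h3
      exact Or.inr (Set.mem_iUnion.2 ⟨i, Or.inl ⟨h1 i, hi⟩⟩)
  · refine le_trans (measure_mono ?_) ((measure_union_le _ _).trans (add_le_add le_rfl (hle n)))
    rintro x ⟨h1, h2⟩
    by_cases h3 : ∀ i, R i n x ∈ U i
    · exact Or.inl ⟨h3, h2⟩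
    · obtain ⟨i, hi⟩ := not_forall.1 h3
      exact Or.inr (Set.mem_iUnion.2 ⟨i, Or.inr ⟨h1 i, hi⟩⟩)

/-- The rectangles `U × J` with `U` measurable and `J` a Borel set with Lebesgue-null frontier. -/
def nullFrontierRectangles (X : Type*) [MeasurableSpace X] : Set (Set (X × ℝ)) :=
  Set.image2 (· ×ˢ ·) {U | MeasurableSet U} {J | MeasurableSet J ∧ volume (frontier J) = 0}

theorem isPiSystem_nullFrontierRectangles (X : Type*) [MeasurableSpace X] :
    IsPiSystem (nullFrontierRectangles X) := by
  refine MeasurableSpace.isPiSystem_measurableSet.prod ?_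
  intro J hJ J' hJ' _
  refine ⟨hJ.1.inter hJ'.1, measure_mono_null (frontier_inter_subset J J') ?_⟩
  exact measure_union_null (measure_mono_null Set.inter_subset_left hJ.2)
    (measure_mono_null Set.inter_subset_right hJ'.2)

theorem univ_mem_nullFrontierRectangles (X : Type*) [MeasurableSpace X] :
    Set.univ ∈ nullFrontierRectangles X :=
  ⟨Set.univ, MeasurableSet.univ, Set.univ, ⟨MeasurableSet.univ, by simp⟩, Set.univ_prod_univ⟩

theorem generateFrom_nullFrontierRectangles (X : Type*) [MeasurableSpace X] :
    (Prod.instMeasurableSpace : MeasurableSpace (X × ℝ)) =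
      MeasurableSpace.generateFrom (nullFrontierRectangles X) := by
  have hspan : IsCountablySpanning {J : Set ℝ | MeasurableSet J ∧ volume (frontier J) = 0} :=
    ⟨fun _ => Set.univ, fun _ => ⟨MeasurableSet.univ, by simp⟩, Set.iUnion_const _⟩
  refine (generateFrom_eq_prod MeasurableSpace.generateFrom_measurableSet ?_
    isCountablySpanning_measurableSet hspan).symm
  refine le_antisymm (MeasurableSpace.generateFrom_le fun J hJ => hJ.1) ?_
  refine ((BorelSpace.measurable_eq (α := ℝ)).trans (borel_eq_generateFrom_Iic ℝ)).le.trans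
    (MeasurableSpace.generateFrom_mono ?_)
  rintro _ ⟨a, rfl⟩
  exact ⟨measurableSet_Iic, by simp⟩

section SkewLimit

variable {X ι : Type*} [Fintype ι] [MeasurableSpace X] {μ : Measure X} [IsProbabilityMeasure μ]
  {T : X → X}

/-- The limit of the joint law of the points `(R i n x, r - F n x i)` on rectangles: on almost every
slice `r = const` it follows from asymptotic independence and rigidity, and dominated convergence
integrates it over `r`. -/
theorem tendsto_prod_measure_inter_rectangles (hT : Ergodic T μ) (R : ι → ℕ → X → X)
    (hR : ∀ i n, Measurable (R i n))
    (hrig : ∀ i, ∀ A, MeasurableSet A →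
      Tendsto (fun n => μ (symmDiff (R i n ⁻¹' A) A)) atTop (𝓝 0))
    (F : ℕ → X → ι → ℝ) (hF : ∀ n, Measurable (F n))
    (hinv : Tendsto (fun n => eLpNorm (fun x => F n (T x) - F n x) 2 μ) atTop (𝓝 0))
    (P : Measure (ι → ℝ)) [IsProbabilityMeasure P]
    (hP : TendstoInDistribution F atTop id (fun _ => μ) P)
    (V : Set (X × ℝ)) (hV : MeasurableSet V) (hVfin : (μ.prod volume) V ≠ ∞)
    (U : ι → Set X) (hU : ∀ i, MeasurableSet (U i)) (J : ι → Set ℝ)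
    (hJ : ∀ i, MeasurableSet (J i)) (hJ' : ∀ i, volume (frontier (J i)) = 0) :
    Tendsto (fun n => (μ.prod volume) (V ∩ {p | ∀ i, R i n p.1 ∈ U i ∧ p.2 - F n p.1 i ∈ J i}))
      atTop (𝓝 (∫⁻ t, (μ.prod volume) (V ∩ {p | ∀ i, p.1 ∈ U i ∧ p.2 - t i ∈ J i}) ∂P)) := by
  -- `W r` and `S r` are the slices at height `r` of `V` and of the condition on `t`.
  let W : ℝ → Set X := fun r => (fun x => (x, r)) ⁻¹' V
  let S : ℝ → Set (ι → ℝ) := fun r => {t | ∀ i, r - t i ∈ J i}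
  let Q : Set X := {x | ∀ i, x ∈ U i}
  have hW : ∀ r, MeasurableSet (W r) := fun r => measurable_prodMk_right hV
  have hQ : MeasurableSet Q := by
    simp only [Q, Set.ofPred_forall]
    exact MeasurableSet.iInter fun i => hU i
  have hS2 : MeasurableSet {z : (ι → ℝ) × ℝ | z.1 ∈ S z.2} := by
    have e : {z : (ι → ℝ) × ℝ | z.1 ∈ S z.2} = ⋂ i, (fun z => z.2 - z.1 i) ⁻¹' J i := by
      ext z; simp [S]
    rw [e]
    exact MeasurableSet.iInter fun i => (hJ i).preimage (by fun_prop)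
  have hS : ∀ r, MeasurableSet (S r) := fun r => measurable_prodMk_right hS2
  have hWQ : Measurable fun r => μ (W r ∩ Q) :=
    measurable_measure_prodMk_right (hV.inter (hQ.preimage measurable_fst))
  have hlim : ∫⁻ t, (μ.prod volume) (V ∩ {p | ∀ i, p.1 ∈ U i ∧ p.2 - t i ∈ J i}) ∂P =
      ∫⁻ r, μ (W r ∩ Q) * P (S r) := by
    have e1 : ∀ t : ι → ℝ, (μ.prod volume) (V ∩ {p | ∀ i, p.1 ∈ U i ∧ p.2 - t i ∈ J i}) =
        ∫⁻ r, μ (W r ∩ Q) * {z : (ι → ℝ) × ℝ | z.1 ∈ S z.2}.indicator 1 (t, r) := by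
      intro t
      have hm : MeasurableSet (V ∩ {p : X × ℝ | ∀ i, p.1 ∈ U i ∧ p.2 - t i ∈ J i}) := by
        simp only [Set.ofPred_forall]
        exact hV.inter (MeasurableSet.iInter fun i =>
          ((hU i).preimage measurable_fst).inter ((hJ i).preimage (by fun_prop)))
      rw [Measure.prod_apply_symm hm]
      refine lintegral_congr fun r => ?_
      by_cases h : t ∈ S r
      · have h' : (t, r) ∈ {z : (ι → ℝ) × ℝ | z.1 ∈ S z.2} := h
        rw [Set.indicator_of_mem h', Pi.one_apply, mul_one]
        congr 1
        ext x
        have h'' : ∀ i, r - t i ∈ J i := h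
        simp [W, Q, h'']
      · have h' : (t, r) ∉ {z : (ι → ℝ) × ℝ | z.1 ∈ S z.2} := h
        rw [Set.indicator_of_notMem h', mul_zero]
        convert measure_empty (μ := μ)
        refine Set.eq_empty_iff_forall_notMem.2 fun x hx => h fun i => (hx.2 i).2
    simp_rw [e1]
    rw [lintegral_lintegral_swap]
    · refine lintegral_congr fun r => ?_
      rw [lintegral_const_mul]
      · congr 1
        exact lintegral_indicator_one (hS r)
      · exact (measurable_one.indicator hS2).comp measurable_prodMk_right
    · exact ((hWQ.comp measurable_snd).mul (measurable_one.indicator hS2)).aemeasurable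
  rw [hlim]
  have hmeas : ∀ n, MeasurableSet
      (V ∩ {p : X × ℝ | ∀ i, R i n p.1 ∈ U i ∧ p.2 - F n p.1 i ∈ J i}) := by
    intro n
    have h1 : ∀ i, Measurable fun p : X × ℝ => p.2 - F n p.1 i := fun i =>
      measurable_snd.sub ((measurable_pi_apply i).comp ((hF n).comp measurable_fst))
    simp only [Set.ofPred_forall]
    exact hV.inter (MeasurableSet.iInter fun i =>
      ((hU i).preimage ((hR i n).comp measurable_fst)).inter ((hJ i).preimage (h1 i)))
  simp_rw [fun n => Measure.prod_apply_symm (μ := μ) (ν := volume) (hmeas n)]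
  refine tendsto_lintegral_of_dominated_convergence (fun r => μ (W r))
    (fun n => measurable_measure_prodMk_right (hmeas n))
    (fun n => ae_of_all _ fun r => measure_mono fun x hx => hx.1) ?_ ?_
  · rwa [← Measure.prod_apply_symm hV]
  · filter_upwards [ae_measure_frontier_eq_zero P J hJ'] with r hr
    have h1 := tendsto_measure_inter_preimage_of_ergodic hT F hF hinv P hP (W r ∩ Q)
      ((hW r).inter hQ) (S r) (hS r) hr
    have h2 := tendsto_measure_inter_rigid R hrig U hU (fun n => W r ∩ F n ⁻¹' S r)
      (μ (W r ∩ Q) * P (S r)) (ENNReal.mul_ne_top (measure_ne_top _ _) (measure_ne_top _ _))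
      (h1.congr fun n => by congr 1; ext x; simp only [Q, Set.mem_inter_iff]; tauto)
    refine h2.congr fun n => ?_
    congr 1
    ext x
    simp only [W, S, Set.mem_inter_iff, Set.mem_preimage, Set.mem_ofPred_eq, forall_and]
    tauto

/-- Under the restriction of `μ ⊗ Lebesgue` to a set of finite measure, the points
`(R i n x, r - F n x i)` are jointly distributed in the limit like the points `(x, r - t i)` with
`t` of law `P` and independent of `(x, r)`, in the strong sense of convergence on all measurable
boxes. -/
theorem tendsto_prod_measure_inter_skew (hT : Ergodic T μ) (R : ι → ℕ → X → X)
    (hR : ∀ i n, MeasurePreserving (R i n) μ μ)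
    (hrig : ∀ i, ∀ A, MeasurableSet A →
      Tendsto (fun n => μ (symmDiff (R i n ⁻¹' A) A)) atTop (𝓝 0))
    (F : ℕ → X → ι → ℝ) (hF : ∀ n, Measurable (F n))
    (hbdd : ∀ i, ∃ C : ℝ≥0, ∀ n, eLpNorm (fun x => F n x i) 2 μ ≤ C)
    (hinv : Tendsto (fun n => eLpNorm (fun x => F n (T x) - F n x) 2 μ) atTop (𝓝 0))
    (P : Measure (ι → ℝ)) [IsProbabilityMeasure P]
    (hP : TendstoInDistribution F atTop id (fun _ => μ) P)
    (V : Set (X × ℝ)) (hV : MeasurableSet V) (hVfin : (μ.prod volume) V ≠ ∞)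
    (A : ι → Set (X × ℝ)) (hA : ∀ i, MeasurableSet (A i)) :
    Tendsto (fun n => (μ.prod volume) (V ∩ {p | ∀ i, (R i n p.1, p.2 - F n p.1 i) ∈ A i}))
      atTop (𝓝 (∫⁻ t, (μ.prod volume) (V ∩ {p | ∀ i, (p.1, p.2 - t i) ∈ A i}) ∂P)) := by
  let m := (μ.prod (volume : Measure ℝ)).restrict V
  have hm : IsFiniteMeasure m := ⟨by simpa [m] using hVfin.lt_top⟩
  have hFi : ∀ n i, Measurable fun x => F n x i := fun n i =>
    (measurable_pi_apply i).comp (hF n)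
  let φ : ℕ → X × ℝ → ι → X × ℝ := fun n p i => (R i n p.1, p.2 - F n p.1 i)
  let ψ : (ι → ℝ) × (X × ℝ) → ι → X × ℝ := fun z i => (z.2.1, z.2.2 - z.1 i)
  have hφ : ∀ n, Measurable (φ n) := fun n => measurable_pi_lambda _ fun i =>
    ((hR i n).measurable.comp measurable_fst).prodMk
      (measurable_snd.sub ((hFi n i).comp measurable_fst))
  have hψ : Measurable ψ := measurable_pi_lambda _ fun i => by fun_prop
  have e1 : ∀ n, ∀ B : ι → Set (X × ℝ), (∀ i, MeasurableSet (B i)) →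
      (m.map (φ n)) (Set.univ.pi B) =
        (μ.prod volume) (V ∩ {p | ∀ i, (R i n p.1, p.2 - F n p.1 i) ∈ B i}) := by
    intro n B hB
    have hpi := MeasurableSet.univ_pi hB
    rw [Measure.map_apply (hφ n) hpi, Measure.restrict_apply (hφ n hpi), Set.inter_comm]
    congr 2
    ext p
    simp [φ]
  have e2 : ∀ B : ι → Set (X × ℝ), (∀ i, MeasurableSet (B i)) →
      ((P.prod m).map ψ) (Set.univ.pi B) =
        ∫⁻ t, (μ.prod volume) (V ∩ {p | ∀ i, (p.1, p.2 - t i) ∈ B i}) ∂P := by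
    intro B hB
    have hpi := MeasurableSet.univ_pi hB
    rw [Measure.map_apply hψ hpi, Measure.prod_apply (hψ hpi)]
    refine lintegral_congr fun t => ?_
    rw [Measure.restrict_apply (measurable_prodMk_left (hψ hpi)), Set.inter_comm]
    congr 2
    ext p
    simp [ψ]
  have hmeas : ∀ B ∈ nullFrontierRectangles X, MeasurableSet B := by
    rintro _ ⟨U, hU, J, hJ, rfl⟩
    exact MeasurableSet.prod hU hJ.1
  have key := tendsto_measure_pi_of_isPiSystem (fun n => m.map (φ n)) ((P.prod m).map ψ)
    (nullFrontierRectangles X) (generateFrom_nullFrontierRectangles X)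
    (isPiSystem_nullFrontierRectangles X) (univ_mem_nullFrontierRectangles X) ?_ ?_ A hA
  · simp_rw [e2 A hA, fun n => e1 n A hA] at key
    exact key
  · intro B hB
    simp_rw [e2 B fun i => hmeas _ (hB i), fun n => e1 n B fun i => hmeas _ (hB i)]
    choose U hU J hJ hUJ using hB
    simp_rw [← hUJ]
    exact tendsto_prod_measure_inter_rectangles hT R (fun i n => (hR i n).measurable) hrig F hF
      hinv P hP V hV hVfin U hU J (fun i => (hJ i).1) fun i => (hJ i).2
  · intro i D hDa hDm hDe ε hε
    obtain ⟨C, hC⟩ := hbdd i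
    obtain ⟨K, hK⟩ := exists_measure_inter_skew_preimage_le (R i) (hR i) (fun n x => F n x i)
      (fun n => hFi n i) C hC V hV hVfin D hDa hDm hDe ε hε
    refine ⟨K, fun n => ?_⟩
    have hDi : MeasurableSet ((fun y : ι → X × ℝ => y i) ⁻¹' D K) :=
      (hDm K).preimage (measurable_pi_apply i)
    rw [Measure.map_apply (hφ n) hDi, Measure.restrict_apply (hφ n hDi), Set.inter_comm]
    exact hK n

end SkewLimit

/-! ### The cocycle and its skew product -/

section Cocycle

variable {X : Type*} (T : Equiv.Perm X) (f : X → ℝ)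

theorem cocycle_zero (x : X) : cocycle T f 0 x = 0 := by simp [cocycle]

theorem cocycle_add (n k : ℤ) (x : X) :
    cocycle T f (n + k) x = cocycle T f k x + cocycle T f n ((T ^ k) x) := by
  induction n using Int.induction_on with
  | zero => simp [cocycle_zero]
  | succ i ih =>
    rw [add_right_comm, cocycle_add_one, ih, cocycle_add_one, zpow_add, Equiv.Perm.mul_apply,
      add_assoc]
  | pred i ih =>
    have h1 := cocycle_add_one T f (-(i : ℤ) - 1 + k) x
    have h2 := cocycle_add_one T f (-(i : ℤ) - 1) ((T ^ k) x)
    rw [← Equiv.Perm.mul_apply, ← zpow_add] at h2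
    rw [show -(i : ℤ) - 1 + k + 1 = -(i : ℤ) + k by ring, ih] at h1
    rw [sub_add_cancel] at h2
    linarith

theorem cocycle_sub_const (c : ℝ) (k : ℤ) (x : X) :
    cocycle T (fun x => f x - c) k x = cocycle T f k x - k * c := by
  induction k using Int.induction_on with
  | zero => simp [cocycle_zero]
  | succ i ih =>
    rw [cocycle_add_one, ih, cocycle_add_one]
    push_cast
    ring
  | pred i ih =>
    have h1 := cocycle_add_one T (fun x => f x - c) (-(i : ℤ) - 1) x
    have h2 := cocycle_add_one T f (-(i : ℤ) - 1) x
    rw [sub_add_cancel] at h1 h2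
    push_cast at *
    linarith

/-- The coboundary identity through which rigidity makes the cocycle asymptotically invariant. -/
theorem cocycle_apply_sub (k : ℤ) (x : X) :
    cocycle T f k (T x) - cocycle T f k x = f ((T ^ k) x) - f x := by
  have h1 := cocycle_add_one T f k x
  have h2 := cocycle_add T f k 1 x
  have h3 := cocycle_add_one T f 0 x
  simp only [zero_add, cocycle_zero, zpow_zero, zpow_one, Equiv.Perm.one_apply] at h2 h3
  linarith

theorem strictMono_cocycle (hf : ∀ x, 0 < f x) (x : X) : StrictMono fun n => cocycle T f n x :=
  strictMono_int_of_lt_succ fun n => by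
    rw [cocycle_add_one]
    exact lt_add_of_pos_right _ (hf _)

/-- The `n`-th power `(x, r) ↦ (T ^ n x, r - f⁽ⁿ⁾ x)` of the skew product on `X × ℝ` whose quotient
is the special flow. -/
noncomputable def skew (n : ℤ) (p : X × ℝ) : X × ℝ := ((T ^ n) p.1, p.2 - cocycle T f n p.1)

/-- The region `0 ≤ s < f x` under the graph, as a subset of `X × ℝ`. -/
def underSet : Set (X × ℝ) := {p | 0 ≤ p.2 ∧ p.2 < f p.1}

theorem skew_zero (p : X × ℝ) : skew T f 0 p = p := by simp [skew, cocycle_zero]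

theorem skew_add (n k : ℤ) (p : X × ℝ) : skew T f (n + k) p = skew T f n (skew T f k p) := by
  simp only [skew, cocycle_add, zpow_add, Equiv.Perm.mul_apply, sub_add_eq_sub_sub]

theorem skew_mem_underSet_iff (n : ℤ) (p : X × ℝ) : skew T f n p ∈ underSet f ↔
    cocycle T f n p.1 ≤ p.2 ∧ p.2 < cocycle T f (n + 1) p.1 := by
  simp only [underSet, skew, cocycle_add_one, Set.mem_ofPred_eq, sub_nonneg, sub_lt_iff_lt_add']

theorem eq_of_skew_mem_underSet (hf : ∀ x, 0 < f x) {n k : ℤ} {p : X × ℝ}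
    (hn : skew T f n p ∈ underSet f) (hk : skew T f k p ∈ underSet f) : n = k := by
  rw [skew_mem_underSet_iff] at hn hk
  have h1 := (strictMono_cocycle T f hf p.1).lt_iff_lt.1 (hn.1.trans_lt hk.2)
  have h2 := (strictMono_cocycle T f hf p.1).lt_iff_lt.1 (hk.1.trans_lt hn.2)
  omega

/-- The points `x` over which every `(x, r)` is brought into the region under the graph by some
power of the skew product, so that the special flow is defined on the fibre for all times. -/
def IsRegular (x : X) : Prop := ∀ r : ℝ, ∃ n : ℤ, skew T f n (x, r) ∈ underSet f

variable {T f}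

theorem IsRegular.zpow_apply {x : X} (hx : IsRegular T f x) (k : ℤ) :
    IsRegular T f ((T ^ k) x) := by
  intro r
  obtain ⟨n, hn⟩ := hx (r + cocycle T f k x)
  refine ⟨n - k, ?_⟩
  have h1 : ((T ^ k) x, r) = skew T f k (x, r + cocycle T f k x) := by simp [skew]
  rwa [h1, ← skew_add, sub_add_cancel]

/-- Linear growth of the cocycle at `x` forwards and backwards makes its values unbounded in both
directions, so that every `r` lies between two consecutive ones. -/
theorem isRegular_of_linear_growth {x : X} {c : ℝ} (hc : 0 < c) (K : ℕ)
    (h1 : ∀ k : ℕ, K ≤ k → c * k ≤ cocycle T f k x)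
    (h2 : ∀ k : ℕ, K ≤ k → c * k ≤ cocycle T f k ((T ^ (-k : ℤ)) x)) : IsRegular T f x := by
  intro r
  have h2' : ∀ k : ℕ, K ≤ k → cocycle T f (-k : ℤ) x ≤ -(c * k) := by
    intro k hk
    have h3 := cocycle_add T f k (-k : ℤ) x
    rw [add_neg_cancel, cocycle_zero] at h3
    linarith [h2 k hk]
  obtain ⟨N, hN⟩ := exists_nat_gt (|r| / c)
  have hbig : ∀ k : ℕ, N ≤ k → |r| < c * k := by
    intro k hk
    rw [div_lt_iff₀ hc] at hN
    have : (N : ℝ) ≤ k := by exact_mod_cast hk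
    nlinarith
  obtain ⟨n, hn1, hn2⟩ := Int.exists_greatest_of_bdd (P := fun n => cocycle T f n x ≤ r)
    ⟨(max N K : ℕ), fun z hz => by
      by_contra! hlt
      obtain ⟨k, rfl⟩ := Int.eq_ofNat_of_zero_le ((Int.natCast_nonneg _).trans hlt.le)
      have hk : max N K ≤ k := by exact_mod_cast hlt.le
      have := h1 k (le_of_max_le_right hk)
      have := hbig k (le_of_max_le_left hk)
      linarith [le_abs_self r]⟩
    ⟨-(max N K : ℕ), by
      have := h2' _ (le_max_right N K)
      have := hbig _ (le_max_left N K)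
      linarith [neg_abs_le r]⟩
  refine ⟨n, (skew_mem_underSet_iff T f n _).2 ⟨hn1, ?_⟩⟩
  by_contra! hlt
  have := hn2 (n + 1) hlt
  omega

end Cocycle

/-! ### The special flow in terms of the skew product -/

section Flow

variable {X : Type*} (T : Equiv.Perm X) (f : X → ℝ)

/-- The invariant set in `X × ℝ` that corresponds to the subset `A` of the phase space: the points
that some power of the skew product takes into `A`. -/
def lift (A : Set (Under f)) : Set (X × ℝ) := ⋃ n : ℤ, skew T f n ⁻¹' (Subtype.val '' A)

variable {T f}

theorem image_val_subset_underSet (A : Set (Under f)) : Subtype.val '' A ⊆ underSet f := by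
  rintro _ ⟨y, -, rfl⟩
  exact y.2

theorem skew_mem_lift_iff (A : Set (Under f)) (k : ℤ) (p : X × ℝ) :
    skew T f k p ∈ lift T f A ↔ p ∈ lift T f A := by
  simp only [lift, Set.mem_iUnion, Set.mem_preimage, ← skew_add]
  exact ⟨fun ⟨n, hn⟩ => ⟨n + k, hn⟩, fun ⟨n, hn⟩ => ⟨n - k, by rwa [sub_add_cancel]⟩⟩

theorem underSet_inter_lift (hf : ∀ x, 0 < f x) (A : Set (Under f)) :
    underSet f ∩ lift T f A = Subtype.val '' A := by
  ext p
  constructor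
  · rintro ⟨h1, h2⟩
    obtain ⟨n, hn⟩ := Set.mem_iUnion.1 h2
    have h0 : n = 0 := eq_of_skew_mem_underSet T f hf (image_val_subset_underSet A hn)
      (by rwa [skew_zero])
    rwa [h0, Set.mem_preimage, skew_zero] at hn
  · intro h
    exact ⟨image_val_subset_underSet A h, Set.mem_iUnion.2 ⟨0, by rwa [Set.mem_preimage, skew_zero]⟩⟩

theorem specialFlow_val (hf : ∀ x, 0 < f x) (t : ℝ) (y : Under f) {n : ℤ}
    (hn : skew T f n (y.1.1, y.1.2 + t) ∈ underSet f) :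
    (specialFlow T f t y).1 = skew T f n (y.1.1, y.1.2 + t) := by
  have h : ∃ n : ℤ, cocycle T f n y.1.1 ≤ y.1.2 + t ∧ y.1.2 + t < cocycle T f (n + 1) y.1.1 :=
    ⟨n, (skew_mem_underSet_iff T f n _).1 hn⟩
  have e : h.choose = n := eq_of_skew_mem_underSet T f hf
    ((skew_mem_underSet_iff T f _ (y.1.1, y.1.2 + t)).2 h.choose_spec) hn
  rw [specialFlow, dif_pos h]
  simp only [skew, e]

theorem specialFlow_mem_iff (hf : ∀ x, 0 < f x) (t : ℝ) (y : Under f)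
    (h : ∃ n : ℤ, skew T f n (y.1.1, y.1.2 + t) ∈ underSet f) (A : Set (Under f)) :
    specialFlow T f t y ∈ A ↔ (y.1.1, y.1.2 + t) ∈ lift T f A := by
  obtain ⟨n, hn⟩ := h
  have h1 := specialFlow_val hf t y hn
  have h2 : specialFlow T f t y ∈ A ↔ (specialFlow T f t y).1 ∈ Subtype.val '' A :=
    (Subtype.val_injective.mem_set_image).symm
  rw [h2, h1, ← underSet_inter_lift hf, Set.mem_inter_iff, skew_mem_lift_iff]
  exact and_iff_right hn

theorem specialFlow_of_not_exists (t : ℝ) (y : Under f)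
    (h : ¬ ∃ n : ℤ, skew T f n (y.1.1, y.1.2 + t) ∈ underSet f) : specialFlow T f t y = y := by
  rw [specialFlow, dif_neg]
  simpa only [skew_mem_underSet_iff] using h

theorem specialFlow_add (hf : ∀ x, 0 < f x) (s t : ℝ) (y : Under f)
    (hy : IsRegular T f y.1.1) :
    specialFlow T f s (specialFlow T f t y) = specialFlow T f (s + t) y := by
  obtain ⟨n, hn⟩ := hy (y.1.2 + t)
  have h1 := specialFlow_val hf t y hn
  obtain ⟨k, hk⟩ := hy.zpow_apply n ((specialFlow T f t y).1.2 + s)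
  have h2 : (specialFlow T f t y).1.1 = (T ^ n) y.1.1 := by rw [h1]; rfl
  rw [← h2] at hk
  have h3 : ((specialFlow T f t y).1.1, (specialFlow T f t y).1.2 + s) =
      skew T f n (y.1.1, y.1.2 + (s + t)) := by
    rw [h1]
    simp only [skew, Prod.mk.injEq, true_and]
    ring
  apply Subtype.ext
  rw [specialFlow_val hf s _ hk]
  rw [h3, ← skew_add] at hk ⊢
  rw [specialFlow_val hf (s + t) y hk]

theorem specialFlow_comm (hf : ∀ x, 0 < f x) (s t : ℝ) (y : Under f)
    (hy : IsRegular T f y.1.1) :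
    specialFlow T f s (specialFlow T f t y) = specialFlow T f t (specialFlow T f s y) := by
  rw [specialFlow_add hf s t y hy, specialFlow_add hf t s y hy, add_comm]

end Flow

/-! ### The special flow preserves the measure -/

/-- Two fundamental domains of a measure-preserving `ℤ`-action give the same measure to an invariant
set. -/
theorem measure_inter_eq_of_fundamental {Z : Type*} [MeasurableSpace Z] (m : Measure Z)
    (S : ℤ → Z → Z) (hS : ∀ n, MeasurePreserving (S n) m m) (hS0 : ∀ z, S 0 z = z)
    (hSadd : ∀ n k z, S (n + k) z = S n (S k z)) (E₁ E₂ G : Set Z) (hE₁ : MeasurableSet E₁)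
    (hE₂ : MeasurableSet E₂) (hG : MeasurableSet G) (h₁ : ∀ᵐ z ∂m, ∃! n, S n z ∈ E₁)
    (h₂ : ∀ᵐ z ∂m, ∃! n, S n z ∈ E₂) (hGS : ∀ n z, S n z ∈ G ↔ z ∈ G) :
    m (E₁ ∩ G) = m (E₂ ∩ G) := by
  have key : ∀ E E' : Set Z, MeasurableSet E → MeasurableSet E' → (∀ᵐ z ∂m, ∃! n, S n z ∈ E') →
      m (E ∩ G) = ∑' n, m (E ∩ S n ⁻¹' E' ∩ G) := by
    intro E E' hE hE' h
    rw [← measure_iUnion₀]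
    · refine measure_congr ?_
      filter_upwards [h] with z hz
      obtain ⟨n, hn, -⟩ := hz
      refine propext ⟨fun h1 => ?_, fun h1 => ?_⟩
      · exact Set.mem_iUnion.2 ⟨n, ⟨h1.1, hn⟩, h1.2⟩
      · obtain ⟨k, hk⟩ := Set.mem_iUnion.1 h1
        exact ⟨hk.1.1, hk.2⟩
    · intro a b hab
      refine measure_mono_null ?_ (ae_iff.1 h)
      intro z hz hz'
      exact hab (hz'.unique hz.1.1.2 hz.2.1.2)
    · intro n
      exact ((hE.inter ((hS n).measurable hE')).inter hG).nullMeasurableSet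
  rw [key E₁ E₂ hE₁ hE₂ h₂, key E₂ E₁ hE₂ hE₁ h₁, ← (Equiv.neg ℤ).tsum_eq]
  refine tsum_congr fun n => ?_
  have e : E₂ ∩ S n ⁻¹' E₁ ∩ G = S n ⁻¹' (E₁ ∩ S (-n) ⁻¹' E₂ ∩ G) := by
    ext z
    simp only [Set.mem_inter_iff, Set.mem_preimage, hGS, ← hSadd, neg_add_cancel, hS0]
    tauto
  rw [e, (hS n).measure_preimage ((hE₁.inter ((hS (-n)).measurable hE₂)).inter hG).nullMeasurableSet]
  rfl

section MeasurePreserving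

variable {X : Type*} [MeasurableSpace X] {μ : Measure X} {T : X ≃ᵐ X} {f : X → ℝ}

theorem measurePreserving_zpow (hT : MeasurePreserving T μ μ) (n : ℤ) :
    MeasurePreserving (fun x => (T.toEquiv ^ n) x) μ μ := by
  induction n using Int.induction_on with
  | zero => exact MeasurePreserving.id μ
  | succ i ih =>
    rw [zpow_add_one]
    exact ih.comp hT
  | pred i ih =>
    rw [zpow_sub_one]
    exact ih.comp (MeasurePreserving.symm T hT)

theorem measurable_zpow (n : ℤ) : Measurable fun x => (T.toEquiv ^ n) x := by
  induction n using Int.induction_on with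
  | zero => exact measurable_id
  | succ i ih =>
    rw [zpow_add_one]
    exact ih.comp T.measurable
  | pred i ih =>
    rw [zpow_sub_one]
    exact ih.comp T.symm.measurable

theorem measurable_cocycle (hf : Measurable f) (n : ℤ) :
    Measurable fun x => cocycle T.toEquiv f n x := by
  unfold cocycle
  exact (Finset.measurable_sum _ fun j _ => hf.comp (measurable_zpow j)).sub
    (Finset.measurable_sum _ fun j _ => hf.comp (measurable_zpow j))

theorem measurable_skew (hf : Measurable f) (n : ℤ) : Measurable (skew T.toEquiv f n) :=
  ((measurable_zpow n).comp measurable_fst).prodMk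
    (measurable_snd.sub ((measurable_cocycle hf n).comp measurable_fst))

theorem measurableSet_underSet (hf : Measurable f) : MeasurableSet (underSet f) :=
  (measurableSet_le measurable_const measurable_snd).inter
    (measurableSet_lt measurable_snd (hf.comp measurable_fst))

theorem measurableSet_image_val (hf : Measurable f) {A : Set (Under f)} (hA : MeasurableSet A) :
    MeasurableSet (Subtype.val '' A) :=
  MeasurableSet.subtype_image (measurableSet_underSet hf) hA

theorem measurableSet_lift (hf : Measurable f) {A : Set (Under f)} (hA : MeasurableSet A) :
    MeasurableSet (lift T.toEquiv f A) :=
  MeasurableSet.iUnion fun n => measurable_skew hf n (measurableSet_image_val hf hA)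

theorem measurable_specialFlow_uncurry (hf : Measurable f) (hpos : ∀ x, 0 < f x) :
    Measurable fun z : ℝ × Under f => specialFlow T.toEquiv f z.1 z.2 := by
  intro A hA
  let q : ℝ × Under f → X × ℝ := fun z => (z.2.1.1, z.2.1.2 + z.1)
  have hq : Measurable q := by fun_prop
  let H : Set (X × ℝ) := ⋃ n : ℤ, skew T.toEquiv f n ⁻¹' underSet f
  have hH : MeasurableSet H :=
    MeasurableSet.iUnion fun n => measurable_skew hf n (measurableSet_underSet hf)
  -- `H` is the set where the flow moves along the orbit; off `H` it fixes the point.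
  have e : (fun z : ℝ × Under f => specialFlow T.toEquiv f z.1 z.2) ⁻¹' A =
      (q ⁻¹' H ∩ q ⁻¹' lift T.toEquiv f A) ∪ ((q ⁻¹' H)ᶜ ∩ Prod.snd ⁻¹' A) := by
    ext z
    by_cases hz : q z ∈ H
    · have h1 := specialFlow_mem_iff hpos z.1 z.2 (Set.mem_iUnion.1 hz) A
      simp [hz, h1, q]
    · have h1 := specialFlow_of_not_exists (T := T.toEquiv) z.1 z.2 fun h => hz (Set.mem_iUnion.2 h)
      simp [hz, h1]
  rw [e]
  exact ((hq hH).inter (hq (measurableSet_lift hf hA))).union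
    ((hq hH).compl.inter (measurable_snd hA))

theorem measurable_specialFlow (hf : Measurable f) (hpos : ∀ x, 0 < f x) (t : ℝ) :
    Measurable (specialFlow T.toEquiv f t) :=
  Measurable.of_uncurry_left (f := specialFlow T.toEquiv f)
    (measurable_specialFlow_uncurry hf hpos)

theorem underMeasure_apply (hf : Measurable f) (A : Set (Under f)) :
    underMeasure μ f A = (μ.prod volume) (Subtype.val '' A) :=
  (MeasurableEmbedding.subtype_coe (measurableSet_underSet hf)).comap_apply _ _

theorem ae_underMeasure_of_ae (hf : Measurable f) [SFinite μ] {p : X → Prop}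
    (h : ∀ᵐ x ∂μ, p x) : ∀ᵐ y ∂underMeasure μ f, p y.1.1 := by
  have h1 : ∀ᵐ z ∂(μ.prod (volume : Measure ℝ)), p z.1 :=
    Measure.quasiMeasurePreserving_fst.ae h
  rw [ae_iff, underMeasure_apply hf]
  refine measure_mono_null ?_ (ae_iff.1 h1)
  rintro _ ⟨y, hy, rfl⟩
  exact hy

theorem isProbabilityMeasure_underMeasure (hf : Measurable f) (hpos : ∀ x, 0 < f x) [SFinite μ]
    (hint : Integrable f μ) (h1 : ∫ x, f x ∂μ = 1) : IsProbabilityMeasure (underMeasure μ f) := by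
  constructor
  rw [underMeasure_apply hf, Set.image_univ]
  have hrange : Set.range (Subtype.val : Under f → X × ℝ) = underSet f := Subtype.range_val
  rw [hrange, Measure.prod_apply (measurableSet_underSet hf)]
  have e : ∀ x, volume (Prod.mk x ⁻¹' underSet f) = ENNReal.ofReal (f x) := by
    intro x
    have : Prod.mk x ⁻¹' underSet f = Set.Ico 0 (f x) := by
      ext r; simp [underSet]
    rw [this, Real.volume_Ico, sub_zero]
  simp_rw [e]
  rw [← ofReal_integral_eq_lintegral_ofReal hint (ae_of_all _ fun x => (hpos x).le), h1,
    ENNReal.ofReal_one]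

theorem measurePreserving_skew [SFinite μ] (hT : MeasurePreserving T μ μ) (hf : Measurable f)
    (n : ℤ) : MeasurePreserving (skew T.toEquiv f n) (μ.prod volume) (μ.prod volume) :=
  (measurePreserving_zpow hT n).skew_product (g := fun x r => r - cocycle T.toEquiv f n x)
    (measurable_snd.sub ((measurable_cocycle hf n).comp measurable_fst))
    (ae_of_all _ fun x => map_sub_right_eq_self volume (cocycle T.toEquiv f n x))

theorem ae_isRegular (hT : MeasurePreserving T μ μ) (hgrowth : ∃ c : ℝ, 0 < c ∧
    ∀ᶠ k : ℕ in atTop, ∀ᵐ x ∂μ, c * k ≤ cocycle T.toEquiv f k x) :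
    ∀ᵐ x ∂μ, IsRegular T.toEquiv f x := by
  obtain ⟨c, hc, h⟩ := hgrowth
  obtain ⟨K, hK⟩ := eventually_atTop.1 h
  have h1 : ∀ᵐ x ∂μ, ∀ k : ℕ, K ≤ k → c * k ≤ cocycle T.toEquiv f k x :=
    ae_all_iff.2 fun k => eventually_imp_distrib_left.2 fun hk => hK k hk
  have h2 : ∀ᵐ x ∂μ, ∀ k : ℕ, K ≤ k →
      c * k ≤ cocycle T.toEquiv f k ((T.toEquiv ^ (-k : ℤ)) x) :=
    ae_all_iff.2 fun k => eventually_imp_distrib_left.2 fun hk =>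
      (measurePreserving_zpow hT (-k)).quasiMeasurePreserving.ae (hK k hk)
  filter_upwards [h1, h2] with x hx1 hx2
  exact isRegular_of_linear_growth hc K hx1 hx2

/-- The special flow preserves the measure: up to a null set, the preimage of `A` at time `t` is cut
out of the invariant set `{(x, r) | (x, r + t) ∈ lift A}` by the region under the graph, while the
vertical translate of that region, another fundamental domain, cuts out a translate of `A`. -/
theorem measurePreserving_specialFlow [SFinite μ] (hT : MeasurePreserving T μ μ)
    (hf : Measurable f) (hpos : ∀ x, 0 < f x) (hreg : ∀ᵐ x ∂μ, IsRegular T.toEquiv f x) (t : ℝ) :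
    MeasurePreserving (specialFlow T.toEquiv f t) (underMeasure μ f) (underMeasure μ f) := by
  refine ⟨measurable_specialFlow hf hpos t, ?_⟩
  ext A hA
  rw [Measure.map_apply (measurable_specialFlow hf hpos t) hA, underMeasure_apply hf,
    underMeasure_apply hf, ← underSet_inter_lift (T := T.toEquiv) hpos A]
  -- The translation `τ` commutes with the skew product, so `τ ⁻¹' underSet f` is also a fundamental
  -- domain.
  let τ : X × ℝ → X × ℝ := fun p => (p.1, p.2 + t)
  have hτ : MeasurePreserving τ (μ.prod volume) (μ.prod volume) :=
    (MeasurePreserving.id μ).prod (measurePreserving_add_right volume t)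
  have hτs : ∀ n p, τ (skew T.toEquiv f n p) = skew T.toEquiv f n (τ p) := by
    intro n p
    simp only [τ, skew, Prod.mk.injEq, true_and]
    ring
  have hreg' : ∀ᵐ p ∂(μ.prod (volume : Measure ℝ)), IsRegular T.toEquiv f p.1 :=
    Measure.quasiMeasurePreserving_fst.ae hreg
  have hE := measurableSet_underSet hf
  have hL := measurableSet_lift (T := T) hf hA
  have hex : ∀ x r, IsRegular T.toEquiv f x → ∃! n, skew T.toEquiv f n (x, r) ∈ underSet f := by
    intro x r hx
    obtain ⟨n, hn⟩ := hx r
    exact ⟨n, hn, fun k hk => eq_of_skew_mem_underSet _ f hpos hk hn⟩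
  have e1 : (μ.prod volume) (Subtype.val '' (specialFlow T.toEquiv f t ⁻¹' A)) =
      (μ.prod volume) (underSet f ∩ τ ⁻¹' lift T.toEquiv f A) := by
    refine measure_congr ?_
    filter_upwards [hreg'] with p hp
    refine propext ⟨?_, ?_⟩
    · rintro ⟨y, hy, rfl⟩
      exact ⟨y.2, (specialFlow_mem_iff hpos t y (hp _) A).1 hy⟩
    · rintro ⟨h1, h2⟩
      exact ⟨⟨p, h1⟩, (specialFlow_mem_iff hpos t ⟨p, h1⟩ (hp _) A).2 h2, rfl⟩
  rw [e1, measure_inter_eq_of_fundamental (μ.prod volume) (skew T.toEquiv f)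
    (measurePreserving_skew hT hf) (skew_zero _ f) (skew_add _ f) (underSet f)
    (τ ⁻¹' underSet f) _ hE (hτ.measurable hE) (hτ.measurable hL)
    (hreg'.mono fun p hp => hex p.1 p.2 hp) ?_ ?_, ← Set.preimage_inter,
    hτ.measure_preimage (hE.inter hL).nullMeasurableSet]
  · filter_upwards [hreg'] with p hp
    simp only [Set.mem_preimage, hτs]
    exact hex p.1 (p.2 + t) hp
  · intro n p
    rw [Set.mem_preimage, hτs, skew_mem_lift_iff]
    rfl

end MeasurePreserving

/-! ### Off-diagonal self-joinings and their averages -/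

theorem measurable_snoc {Y : Type*} [MeasurableSpace Y] {Z : Type*} [MeasurableSpace Z] {d : ℕ}
    {S : Fin d → Z → Y} {u : Z → Y} (hS : ∀ i, Measurable (S i)) (hu : Measurable u) :
    Measurable fun z => (Fin.snoc (fun i => S i z) (u z) : Fin (d + 1) → Y) := by
  refine measurable_pi_lambda _ fun i => ?_
  induction i using Fin.lastCases with
  | last => simpa using hu
  | cast i => simpa using hS i

section Joining

variable {Y : Type*} [MeasurableSpace Y] {φ : ℝ → Y → Y} {ν : Measure Y} {d : ℕ}

theorem isSelfJoining_offDiagonal [IsProbabilityMeasure ν]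
    (hφ : ∀ t, MeasurePreserving (φ t) ν ν)
    (hcomm : ∀ s t, ∀ᵐ y ∂ν, φ s (φ t y) = φ t (φ s y)) (t : Fin d → ℝ) :
    IsSelfJoining φ ν (d + 1) (offDiagonal φ ν t) := by
  have hm : Measurable fun y => (Fin.snoc (fun i => φ (t i) y) y : Fin (d + 1) → Y) :=
    measurable_snoc (fun i => (hφ (t i)).measurable) measurable_id
  refine ⟨Measure.isProbabilityMeasure_map hm.aemeasurable, fun s => ?_, fun i => ?_⟩
  · have hs : Measurable fun (y : Fin (d + 1) → Y) i => φ s (y i) :=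
      measurable_pi_lambda _ fun i => (hφ s).measurable.comp (measurable_pi_apply i)
    refine ⟨hs, ?_⟩
    unfold offDiagonal graphJoining
    rw [Measure.map_map hs hm]
    have e : ((fun (y : Fin (d + 1) → Y) i => φ s (y i)) ∘
        fun y => (Fin.snoc (fun i => φ (t i) y) y : Fin (d + 1) → Y)) =ᵐ[ν]
        (fun y => (Fin.snoc (fun i => φ (t i) y) y : Fin (d + 1) → Y)) ∘ φ s := by
      filter_upwards [ae_all_iff.2 fun i => hcomm s (t i)] with y hy
      ext i
      induction i using Fin.lastCases with
      | last => simp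
      | cast i => simpa using hy i
    rw [Measure.map_congr e, ← Measure.map_map hm (hφ s).measurable, (hφ s).map_eq]
  · unfold offDiagonal graphJoining
    rw [Measure.map_map (measurable_pi_apply i) hm]
    induction i using Fin.lastCases with
    | last =>
      convert Measure.map_id (μ := ν) using 2
      ext y
      simp
    | cast i =>
      convert (hφ (t i)).map_eq using 2
      ext y
      simp

theorem isSelfJoining_bind {Z : Type*} [MeasurableSpace Z] {k : ℕ} (P : Measure Z)
    [IsProbabilityMeasure P] (κ : Z → Measure (Fin k → Y)) (hκ : Measurable κ)
    (hφ : ∀ t, Measurable (φ t)) (h : ∀ z, IsSelfJoining φ ν k (κ z)) :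
    IsSelfJoining φ ν k (P.bind κ) := by
  refine ⟨⟨?_⟩, fun s => ?_, fun i => ?_⟩
  · rw [Measure.bind_apply MeasurableSet.univ hκ.aemeasurable]
    have e : ∀ z, κ z Set.univ = 1 := fun z => (h z).isProbabilityMeasure.measure_univ
    simp [e]
  · have hs : Measurable fun (y : Fin k → Y) i => φ s (y i) :=
      measurable_pi_lambda _ fun i => (hφ s).comp (measurable_pi_apply i)
    refine ⟨hs, ?_⟩
    ext A hA
    rw [Measure.map_apply hs hA, Measure.bind_apply (hs hA) hκ.aemeasurable,
      Measure.bind_apply hA hκ.aemeasurable]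
    exact lintegral_congr fun z => ((h z).invariant s).measure_preimage hA.nullMeasurableSet
  · ext A hA
    have hi : Measurable fun y : Fin k → Y => y i := measurable_pi_apply i
    rw [Measure.map_apply hi hA, Measure.bind_apply (hi hA) hκ.aemeasurable]
    have e : ∀ z, κ z ((fun y => y i) ⁻¹' A) = ν A := fun z => by
      rw [← Measure.map_apply hi hA, (h z).marginal i]
    simp [e]

theorem measurable_offDiagonal [SFinite ν] (hφ : Measurable fun z : ℝ × Y => φ z.1 z.2) :
    Measurable fun t : Fin d → ℝ => offDiagonal φ ν t := by
  have hj : Measurable fun z : (Fin d → ℝ) × Y =>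
      (Fin.snoc (fun i => φ (z.1 i) z.2) z.2 : Fin (d + 1) → Y) :=
    measurable_snoc (fun i => hφ.comp
      (g := fun z : ℝ × Y => φ z.1 z.2) (f := fun z : (Fin d → ℝ) × Y => (z.1 i, z.2))
      (((measurable_pi_apply i).comp measurable_fst).prodMk measurable_snd)) measurable_snd
  refine Measure.measurable_of_measurable_coe _ fun A hA => ?_
  have e : ∀ t : Fin d → ℝ, offDiagonal φ ν t A = ν (Prod.mk t ⁻¹'
      ((fun z : (Fin d → ℝ) × Y =>
        (Fin.snoc (fun i => φ (z.1 i) z.2) z.2 : Fin (d + 1) → Y)) ⁻¹' A)) := fun t =>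
    Measure.map_apply (hj.comp measurable_prodMk_left) hA
  simp_rw [e]
  exact measurable_measure_prodMk_left (hj hA)

theorem offDiagonal_pi (hφ : ∀ t, Measurable (φ t)) (t : Fin d → ℝ) (A : Fin (d + 1) → Set Y)
    (hA : ∀ i, MeasurableSet (A i)) : offDiagonal φ ν t (Set.univ.pi A) =
      ν {y | (∀ i, φ (t i) y ∈ A i.castSucc) ∧ y ∈ A (Fin.last d)} := by
  unfold offDiagonal graphJoining
  have hm : Measurable fun y => (Fin.snoc (fun i => φ (t i) y) y : Fin (d + 1) → Y) :=
    measurable_snoc (fun i => hφ (t i)) measurable_id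
  rw [Measure.map_apply hm (MeasurableSet.univ_pi hA)]
  congr 1
  ext y
  simp [Fin.forall_fin_succ']

theorem summable_half_pow_sum (k : ℕ) :
    Summable fun m : Fin k → ℕ => (1 / 2 : ℝ) ^ (∑ i, m i) := by
  induction k with
  | zero => exact Summable.of_finite
  | succ k ih =>
    rw [← (Fin.consEquiv fun _ => ℕ).summable_iff]
    have h := summable_geometric_two.mul_of_nonneg ih (fun _ => by positivity)
      fun _ => by positivity
    refine h.congr fun z => ?_
    simp [Fin.sum_univ_succ, pow_add]

theorem tendsto_joiningDist {k : ℕ} (L : ℕ → Measure (Fin k → Y)) (L' : Measure (Fin k → Y))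
    [∀ n, IsProbabilityMeasure (L n)] [IsProbabilityMeasure L'] (B : ℕ → Set Y)
    (h : ∀ m : Fin k → ℕ, Tendsto (fun n => L n (Set.univ.pi fun i => B (m i))) atTop
      (𝓝 (L' (Set.univ.pi fun i => B (m i))))) :
    Tendsto (fun n => joiningDist B (L n) L') atTop (𝓝 0) := by
  unfold joiningDist
  rw [← tsum_zero (α := ℝ) (β := Fin k → ℕ)]
  refine tendsto_tsum_of_dominated_convergence (summable_half_pow_sum k) (fun m => ?_)
    (Eventually.of_forall fun n m => ?_)
  · have h1 := (ENNReal.tendsto_toReal (measure_ne_top _ _)).comp (h m)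
    have h2 := ((h1.sub_const (L'.real (Set.univ.pi fun i => B (m i)))).abs).const_mul
      ((1 / 2 : ℝ) ^ (∑ i, m i))
    rw [← measureReal_def, sub_self, abs_zero, mul_zero] at h2
    exact h2
  · have h1 : |(L n).real (Set.univ.pi fun i => B (m i)) -
        L'.real (Set.univ.pi fun i => B (m i))| ≤ 1 :=
      abs_sub_le_of_nonneg_of_le measureReal_nonneg measureReal_le_one measureReal_nonneg
        measureReal_le_one
    rw [Real.norm_eq_abs, abs_mul, abs_abs, abs_of_nonneg (by positivity)]
    exact mul_le_of_le_one_right (by positivity) h1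

end Joining

/-! ### Off-diagonal joinings along rigidity sequences -/

section Main

variable {X : Type*} [MeasurableSpace X] {μ : Measure X} {T : X ≃ᵐ X} {f : X → ℝ}

/-- The measure of a box under an off-diagonal joining of the special flow, written on `X × ℝ`. -/
theorem offDiagonal_specialFlow_pi [SFinite μ] (hf : Measurable f) (hpos : ∀ x, 0 < f x)
    (hreg : ∀ᵐ x ∂μ, IsRegular T.toEquiv f x) {d : ℕ} (t : Fin d → ℝ)
    (A : Fin (d + 1) → Set (Under f)) (hA : ∀ i, MeasurableSet (A i)) :
    offDiagonal (specialFlow T.toEquiv f) (underMeasure μ f) t (Set.univ.pi A) =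
      (μ.prod volume) (Subtype.val '' A (Fin.last d) ∩
        {p | ∀ i : Fin d, (p.1, p.2 + t i) ∈ lift T.toEquiv f (A i.castSucc)}) := by
  rw [offDiagonal_pi (measurable_specialFlow hf hpos) t A hA, underMeasure_apply hf]
  have hreg' : ∀ᵐ p ∂(μ.prod (volume : Measure ℝ)), IsRegular T.toEquiv f p.1 :=
    Measure.quasiMeasurePreserving_fst.ae hreg
  refine measure_congr ?_
  filter_upwards [hreg'] with p hp
  refine propext ⟨?_, ?_⟩
  · rintro ⟨y, ⟨h1, h2⟩, rfl⟩
    exact ⟨⟨y, h2, rfl⟩, fun i => (specialFlow_mem_iff hpos (t i) y (hp _) _).1 (h1 i)⟩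
  · rintro ⟨⟨y, h2, rfl⟩, h1⟩
    exact ⟨y, ⟨fun i => (specialFlow_mem_iff hpos (t i) y (hp _) _).2 (h1 i), h2⟩, rfl⟩

/-- At an integer time `k` the vertical translation by `k` agrees, modulo the skew product, with
`(x, r) ↦ (T ^ k x, r - f₀⁽ᵏ⁾ x)` where `f₀ = f - 1`. -/
theorem mem_lift_add_intCast_iff (A : Set (Under f)) (k : ℤ) (p : X × ℝ) :
    (p.1, p.2 + k) ∈ lift T.toEquiv f A ↔
      ((T.toEquiv ^ k) p.1, p.2 - cocycle T.toEquiv (fun x => f x - 1) k p.1) ∈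
        lift T.toEquiv f A := by
  rw [← skew_mem_lift_iff A k, skew, cocycle_sub_const, mul_one, sub_sub_eq_add_sub]

theorem tendsto_eLpNorm_pi {ι : Type*} [Fintype ι] (g : ℕ → X → ι → ℝ)
    (hg : ∀ n, Measurable (g n))
    (h : ∀ i, Tendsto (fun n => eLpNorm (fun x => g n x i) 2 μ) atTop (𝓝 0)) :
    Tendsto (fun n => eLpNorm (g n) 2 μ) atTop (𝓝 0) := by
  have h1 : Tendsto (fun n => ∑ i, eLpNorm (fun x => ‖g n x i‖) 2 μ) atTop (𝓝 0) := by
    simp_rw [eLpNorm_norm]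
    simpa using tendsto_finsetSum Finset.univ fun i _ => h i
  refine tendsto_of_tendsto_of_tendsto_of_le_of_le tendsto_const_nhds h1 (fun _ => zero_le)
    fun n => ?_
  refine le_trans (eLpNorm_mono_real (g := ∑ i, fun x => ‖g n x i‖) fun x => ?_)
    (eLpNorm_sum_le (fun i _ => ?_) (by norm_num))
  · rw [Finset.sum_apply]
    exact (pi_norm_le_iff_of_nonneg (Finset.sum_nonneg fun i _ => norm_nonneg _)).2 fun i =>
      Finset.single_le_sum (f := fun i => ‖g n x i‖) (fun i _ => norm_nonneg _) (Finset.mem_univ i)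
  · exact ((measurable_pi_apply i).comp (hg n)).norm.aestronglyMeasurable

theorem tendsto_offDiagonal_specialFlow_pi [IsProbabilityMeasure μ]
    [IsFiniteMeasure (underMeasure μ f)] (hT : Ergodic T μ)
    (hf : Measurable f) (hpos : ∀ x, 0 < f x) (hL2 : MemLp f 2 μ)
    (hreg : ∀ᵐ x ∂μ, IsRegular T.toEquiv f x) {d : ℕ} (q : Fin d → ℕ → ℤ)
    (hrig : ∀ i, IsRigiditySequence T.toEquiv μ (q i))
    (hbdd : ∀ i, ∃ C : ℝ≥0, ∀ n,
      eLpNorm (cocycle T.toEquiv (fun x => f x - 1) (q i n)) 2 μ ≤ C)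
    (P : Measure (Fin d → ℝ)) [IsProbabilityMeasure P]
    (hP : TendstoInDistribution
      (fun n x i => cocycle T.toEquiv (fun x => f x - 1) (q i n) x)
      atTop (id : (Fin d → ℝ) → Fin d → ℝ) (fun _ => μ) P)
    (A : Fin (d + 1) → Set (Under f)) (hA : ∀ i, MeasurableSet (A i)) :
    Tendsto (fun n => offDiagonal (specialFlow T.toEquiv f) (underMeasure μ f)
        (fun i => (q i n : ℝ)) (Set.univ.pi A)) atTop
      (𝓝 (∫⁻ t, offDiagonal (specialFlow T.toEquiv f) (underMeasure μ f) (fun i => -t i)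
        (Set.univ.pi A) ∂P)) := by
  have hf1 : Measurable fun x => f x - 1 := hf.sub_const 1
  have hFi : ∀ n i, Measurable fun x => cocycle T.toEquiv (fun x => f x - 1) (q i n) x :=
    fun n i => measurable_cocycle hf1 _
  have hF : ∀ n, Measurable fun x i => cocycle T.toEquiv (fun x => f x - 1) (q i n) x :=
    fun n => measurable_pi_lambda _ fun i => hFi n i
  have hTm : MeasurePreserving T μ μ := hT.toMeasurePreserving
  simp_rw [offDiagonal_specialFlow_pi hf hpos hreg _ A hA, mem_lift_add_intCast_iff,
    ← sub_eq_add_neg]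
  refine tendsto_prod_measure_inter_skew hT (fun i n x => (T.toEquiv ^ q i n) x)
    (fun i n => measurePreserving_zpow hTm _) (fun i => (hrig i).2) _ hF hbdd ?_ P hP _
    (measurableSet_image_val hf (hA _)) ?_ _ fun i => measurableSet_lift hf (hA _)
  · refine tendsto_eLpNorm_pi _ (fun n => ((hF n).comp T.measurable).sub (hF n)) fun i => ?_
    have h := tendsto_eLpNorm_comp_sub_of_rigid (fun n x => (T.toEquiv ^ q i n) x)
      (fun n => measurePreserving_zpow hTm _) (hrig i).2 f hL2
    refine h.congr fun n => ?_
    congr 1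
    ext x
    have := cocycle_apply_sub T.toEquiv (fun x => f x - 1) (q i n) x
    simp only [Pi.sub_apply]
    rw [sub_sub_sub_cancel_right] at this
    exact this.symm
  · rw [← underMeasure_apply hf]
    exact measure_ne_top _ _

end Main

end SpecialFlowJoinings

theorem mainTheorem2 {X : Type*} [MeasurableSpace X] [StandardBorelSpace X]
    (μ : Measure X) [IsProbabilityMeasure μ] (T : X ≃ᵐ X) (hT : Ergodic T μ)
    (f : X → ℝ) (hf_meas : Measurable f) (hf_pos : ∀ x, 0 < f x) (hf_L2 : MemLp f 2 μ)
    (hf_int : ∫ x, f x ∂μ = 1)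
    (hf_growth : ∃ c : ℝ, 0 < c ∧ ∀ᶠ k : ℕ in atTop, ∀ᵐ x ∂μ,
      c * k ≤ SpecialFlowJoinings.cocycle T.toEquiv f k x)
    (d : ℕ) (q : Fin d → ℕ → ℤ)
    (hq_rigid : ∀ i, SpecialFlowJoinings.IsRigiditySequence T.toEquiv μ (q i))
    (hq_bdd : ∀ i, ∃ C : ℝ≥0, ∀ n,
      eLpNorm (SpecialFlowJoinings.cocycle T.toEquiv (fun x => f x - ∫ y, f y ∂μ) (q i n)) 2 μ ≤ C)
    (P : Measure (Fin d → ℝ)) [IsProbabilityMeasure P]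
    (hP : TendstoInDistribution
      (fun n x i => SpecialFlowJoinings.cocycle T.toEquiv (fun x => f x - ∫ y, f y ∂μ) (q i n) x)
      atTop (id : (Fin d → ℝ) → Fin d → ℝ) (fun _ => μ) P) :
    (∀ t : Fin d → ℝ,
      SpecialFlowJoinings.IsSelfJoining (SpecialFlowJoinings.specialFlow T.toEquiv f)
        (SpecialFlowJoinings.underMeasure μ f) (d + 1)
        (SpecialFlowJoinings.offDiagonal (SpecialFlowJoinings.specialFlow T.toEquiv f)
          (SpecialFlowJoinings.underMeasure μ f) t)) ∧
    SpecialFlowJoinings.IsSelfJoining (SpecialFlowJoinings.specialFlow T.toEquiv f)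
      (SpecialFlowJoinings.underMeasure μ f) (d + 1)
      (P.bind fun t => SpecialFlowJoinings.offDiagonal
        (SpecialFlowJoinings.specialFlow T.toEquiv f)
        (SpecialFlowJoinings.underMeasure μ f) fun i => -t i) ∧
    SpecialFlowJoinings.JoiningTendsto (SpecialFlowJoinings.underMeasure μ f)
      (fun n => SpecialFlowJoinings.offDiagonal
        (SpecialFlowJoinings.specialFlow T.toEquiv f)
        (SpecialFlowJoinings.underMeasure μ f) fun i => (q i n : ℝ))
      (P.bind fun t => SpecialFlowJoinings.offDiagonal
        (SpecialFlowJoinings.specialFlow T.toEquiv f)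
        (SpecialFlowJoinings.underMeasure μ f) fun i => -t i) := by
  have hTm : MeasurePreserving T μ μ := hT.toMeasurePreserving
  have hreg := SpecialFlowJoinings.ae_isRegular hTm hf_growth
  simp_rw [hf_int] at hq_bdd hP
  have hν : IsProbabilityMeasure (SpecialFlowJoinings.underMeasure μ f) :=
    SpecialFlowJoinings.isProbabilityMeasure_underMeasure hf_meas hf_pos
      (hf_L2.integrable (by norm_num)) hf_int
  have hoff : ∀ t : Fin d → ℝ, SpecialFlowJoinings.IsSelfJoining _ _ (d + 1)
      (SpecialFlowJoinings.offDiagonal (SpecialFlowJoinings.specialFlow T.toEquiv f)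
        (SpecialFlowJoinings.underMeasure μ f) t) := fun t =>
    SpecialFlowJoinings.isSelfJoining_offDiagonal
      (SpecialFlowJoinings.measurePreserving_specialFlow hTm hf_meas hf_pos hreg)
      (fun s t => (SpecialFlowJoinings.ae_underMeasure_of_ae hf_meas hreg).mono fun y hy =>
        SpecialFlowJoinings.specialFlow_comm hf_pos s t y hy) t
  have hκ : Measurable fun t : Fin d → ℝ => SpecialFlowJoinings.offDiagonal
      (SpecialFlowJoinings.specialFlow T.toEquiv f)
      (SpecialFlowJoinings.underMeasure μ f) fun i => -t i :=
    (SpecialFlowJoinings.measurable_offDiagonal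
      (SpecialFlowJoinings.measurable_specialFlow_uncurry hf_meas hf_pos)).comp measurable_neg
  have hbind := SpecialFlowJoinings.isSelfJoining_bind P _ hκ
    (SpecialFlowJoinings.measurable_specialFlow hf_meas hf_pos) fun t => hoff fun i => -t i
  have hbox : ∀ A : Fin (d + 1) → Set (SpecialFlowJoinings.Under f),
      (∀ i, MeasurableSet (A i)) → Tendsto (fun n => SpecialFlowJoinings.offDiagonal
        (SpecialFlowJoinings.specialFlow T.toEquiv f) (SpecialFlowJoinings.underMeasure μ f)
        (fun i => (q i n : ℝ)) (Set.univ.pi A)) atTop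
        (𝓝 ((P.bind fun t => SpecialFlowJoinings.offDiagonal
          (SpecialFlowJoinings.specialFlow T.toEquiv f)
          (SpecialFlowJoinings.underMeasure μ f) fun i => -t i) (Set.univ.pi A))) := by
    intro A hA
    rw [Measure.bind_apply (MeasurableSet.univ_pi hA) hκ.aemeasurable]
    exact SpecialFlowJoinings.tendsto_offDiagonal_specialFlow_pi hT hf_meas hf_pos hf_L2 hreg q
      hq_rigid hq_bdd P hP A hA
  refine ⟨hoff, hbind, hbox, fun B hB => ?_⟩
  have := hbind.isProbabilityMeasure
  have := fun n => (hoff fun i => (q i n : ℝ)).isProbabilityMeasure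
  exact SpecialFlowJoinings.tendsto_joiningDist _ _ B fun m => hbox _ fun i => hB.1 (m i)
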